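/- Let $d\ge 1$ and let $S\subset\mathbb{R}^d$ be a bounded closed convex set with non-empty interior and centroid at the origin. Let $\mathcal{P}$ be a homogeneous Poisson point process of unit intensity on $\mathbb{R}^d\times\mathbb{R}_+$, where $\mathbb{R}_+=[0,\infty)$ (intensity measure $dx\times ds$); a point $(x,t)$ has location $x$ and time mark $t$. Two points $(x,t)$ and $(y,u)$ are called adjacent if $(x+S)\cap(y+S)\ne\emptyset$. For $\mathcal{X}\subset\mathbb{R}^d\times\mathbb{R}_+$ with $\mathcal{X}\cap(\mathbb{R}^d\times[0,t])$ finite for all $t>0$, list the points of $\mathcal{X}$ in order of increasing time marks, ties being broken by the lexicographic order on $\mathbb{R}^d$; the first point is accepted, and each subsequent point is accepted if and only if it is not adjacent to any previously accepted point. For bounded Borel $A\subset\mathbb{R}^d$ let $\xi^*(\mathcal{X},A)$ be the number of accepted points of $\mathcal{X}$ which lie in $A\times\mathbb{R}_+$. For $\lambda>0$ put $a\mathcal{X}:=\{(ax,t):(x,t)\in\mathcal{X}\}$, $\mathcal{P}_\lambda:=\lambda^{-1/d}\mathcal{P}$ (a Poisson process of intensity $\lambda$), $\xi^*_\lambda(\mathcal{X},A):=\xi^*(\lambda^{1/d}\mathcal{X},\lambda^{1/d}A)$,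 and $$N_\lambda^{\xi^*}:=\xi^*_\lambda\bigl(\mathcal{P}_\lambda\cap([0,1)^d\times\mathbb{R}_+),\,[0,1]^d\bigr),$$ the number of solids packed when the locations of the points of $\mathcal{P}\cap([0,\lambda^{1/d})^d\times\mathbb{R}_+)$ are used, in order of increasing time marks, as the input of random sequential adsorption with infinite input. Then $N_\lambda^{\xi^*}$ is a square-integrable random variable for every $\lambda>0$, and $$\liminf_{\lambda\to\infty}\lambda^{-1}\,\mathrm{Var}\bigl[N_\lambda^{\xi^*}\bigr]>0 .$$ -/

import Mathlib

open MeasureTheory ProbabilityTheory Filter Set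
open scoped NNReal ENNReal Pointwise

noncomputable section

namespace RSA

/-- Space `ℝᵈ`; only its vector space structure, Lebesgue measure and boundedness are used. -/
abbrev Space (d : ℕ) : Type := Fin d → ℝ

/-- Space-time `ℝᵈ × ℝ₊`: a point `(x, t)` has location `x` and time mark `t`. -/
abbrev SpaceTime (d : ℕ) : Type := Space d × ℝ≥0

/-- Lebesgue measure on `ℝ₊ = [0, ∞)`. -/
def timeMeasure : Measure ℝ≥0 := Measure.comap ((↑) : ℝ≥0 → ℝ) volume

/-- The intensity `dx × ds` on `ℝᵈ × ℝ₊`. -/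
def intensity (d : ℕ) : Measure (SpaceTime d) := (volume : Measure (Space d)).prod timeMeasure

/-- A random point set `X` is a Poisson point process with intensity measure `ν`: the number of
points in every measurable set is a random variable, it is Poisson distributed with mean `ν B` when
`ν B < ∞`, and the numbers of points in pairwise disjoint measurable sets are independent. -/
structure IsPoissonProcess {Ω α : Type*} [MeasurableSpace Ω] [MeasurableSpace α]
    (X : Ω → Set α) (ν : Measure α) (P : Measure Ω) : Prop where
  measurable_count : ∀ B : Set α, MeasurableSet B → Measurable fun ω => (X ω ∩ B).encard
  map_count : ∀ B : Set α, MeasurableSet B → ν B ≠ ∞ →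
    P.map (fun ω => (X ω ∩ B).encard) = (poissonMeasure (ν B).toNNReal).map (Nat.cast : ℕ → ℕ∞)
  indep_count : ∀ (n : ℕ) (B : Fin n → Set α), (∀ i, MeasurableSet (B i)) →
    Pairwise (fun i j => Disjoint (B i) (B j)) →
      iIndepFun (fun i ω => (X ω ∩ B i).encard) P

/-- A solid: a bounded closed convex set with non-empty interior and centroid at the origin. -/
structure IsSolid {d : ℕ} (S : Set (Space d)) : Prop where
  bounded : Bornology.IsBounded S
  closed : IsClosed S
  convex : Convex ℝ S
  interior_nonempty : (interior S).Nonempty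
  centroid : ∫ x in S, x = 0

/-- Points `(x, t)` and `(y, u)` are adjacent if `(x + S) ∩ (y + S) ≠ ∅`. -/
def Adjacent {d : ℕ} (S : Set (Space d)) (p q : SpaceTime d) : Prop :=
  ((p.1 +ᵥ S) ∩ (q.1 +ᵥ S)).Nonempty

/-- `p` is listed before `q`: increasing time marks, ties broken by the lexicographic order. -/
def Precedes {d : ℕ} (p q : SpaceTime d) : Prop :=
  p.2 < q.2 ∨ (p.2 = q.2 ∧ toLex p.1 < toLex q.1)

/-- The set of accepted points among the first `n` points of the list of `X`: the next point, i.e.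
the point with exactly `n` points of `X` listed before it, is accepted if it is not adjacent to any
previously accepted point. -/
def acceptedAmongFirst {d : ℕ} (S : Set (Space d)) (X : Set (SpaceTime d)) :
    ℕ → Set (SpaceTime d)
  | 0 => ∅
  | n + 1 => acceptedAmongFirst S X n ∪
      {p | p ∈ X ∧ {q | q ∈ X ∧ Precedes q p}.encard = n ∧
        ∀ q ∈ acceptedAmongFirst S X n, ¬ Adjacent S p q}

/-- `𝒜(X)`: all accepted points when `X` is packed in order of its list. (For temporally locally
finite `X`, every point of `X` has only finitely many points of `X` listed before it.) -/
def accepted {d : ℕ} (S : Set (Space d)) (X : Set (SpaceTime d)) : Set (SpaceTime d) :=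
  ⋃ n, acceptedAmongFirst S X n

/-- `A₊ = A × ℝ₊`. -/
def cylinder {d : ℕ} (A : Set (Space d)) : Set (SpaceTime d) := A ×ˢ univ

/-- `ξ*(X, A)` for bounded `A`: the number of points of `𝒜(X)` which lie in `A₊`. This number is
finite, as only a bounded number of solids can be packed in a bounded region. -/
def xiStar {d : ℕ} (S : Set (Space d)) (X : Set (SpaceTime d)) (A : Set (Space d)) : ℝ :=
  ((accepted S X ∩ cylinder A).ncard : ℝ)

/-- `aX = {(ax, t) : (x, t) ∈ X}`: scaling acts on the spatial components only. -/
def scale {d : ℕ} (a : ℝ) (X : Set (SpaceTime d)) : Set (SpaceTime d) :=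
  (fun p : SpaceTime d => (a • p.1, p.2)) '' X

/-- `ξ*_l(X, A) = ξ*(l^{1/d} X, l^{1/d} A)`. -/
def xiStarScaled {d : ℕ} (S : Set (Space d)) (l : ℝ) (X : Set (SpaceTime d)) (A : Set (Space d)) :
    ℝ :=
  xiStar S (scale (l ^ (1 / d : ℝ)) X) ((l ^ (1 / d : ℝ)) • A)

/-- The cube `Q_1 = [0, 1)ᵈ`. -/
def unitCube (d : ℕ) : Set (Space d) := univ.pi fun _ => Ico 0 1

/-- The point process `𝒫_l = l^{-1/d} 𝒫` of intensity `l`, for `𝒫` of intensity `1`. -/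
def scaledProcess {Ω : Type*} {d : ℕ} (X : Ω → Set (SpaceTime d)) (l : ℝ) (ω : Ω) :
    Set (SpaceTime d) :=
  scale (l ^ (-(1 / d : ℝ))) (X ω)

/-- `N_l^{ξ*} = ξ*_l(𝒫_l ∩ (Q_1)₊, [0,1]ᵈ)`, the total mass of the random packing point measure
`ξ*_l(𝒫_l ∩ (Q_1)₊, ·)`. -/
def packingNumber {Ω : Type*} {d : ℕ} (S : Set (Space d)) (X : Ω → Set (SpaceTime d)) (l : ℝ)
    (ω : Ω) : ℝ :=
  xiStarScaled S l (scaledProcess X l ω ∩ cylinder (unitCube d)) (Icc 0 1)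

end RSA

end

/-! The variance is produced by many independent local switches. A switch lives in a cube `Q` with
an inner region `W`. Suppose the points of `Q \ W` arriving before time 1 are exactly one near each
site of a shell `H`, and those of `W` exactly one near each site of `G` or of `G'`. All these early
points are accepted. A later point outside `W` that could conflict with a point of `W` is blocked by
the shell, so the packing outside `W` does not feel what happens inside
(`IsSwitch.accepted_outside`). With `G` at least `G.card` points are accepted in `W`, with `G'`
strictly fewer, whatever arrives later (`IsSwitch.ncard_dense`, `IsSwitch.ncard_sparse`).

Switches exist (`exists_isSwitch`) because adjacency reads `p (x - y) ≤ 1` for a norm `p`, and a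
maximal periodic 1-separated set `A` has covering radius `ρ < 1` (`exists_periodic`). For `s > 1`
with `s * s * ρ < 1`, both `s • A` and `(s * s) • A` are packings with room to spare, and the second
still leaves no hole for another solid. In a large cube the first has more points by an amount of
volume order, whereas solids added to the second fit only near the boundary.

Let `E`, `A`, `B` be the events of the shell, dense and sparse patterns of one translate of the
switch. The variable `Z = 1_E (1_A / P(A) - 1_B / P(B))` is bounded and centred, and disjoint
translates give uncorrelated copies. As the packing number drops by at least one from `A` to `B`,
its correlation with `Z` is at least `P(E)`. Testing it against the sum of order `λ` such variables
bounds its variance below by a multiple of `λ` (`variance_ge_card_mul`).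

Independence and square integrability need the packing number to be measurable in terms of point
counts. This comes from packing the occupied cells of a fine grid, which for a finite input
eventually gives the right number (`IsPoissonProcess.exists_measurable_accepted`). -/

namespace RSA

/-! ### Greedy packing along an abstract order. -/

section Packing

variable {α β : Type*}

/-- `A` is the set accepted from the input `F`, listed in the order `r`: a point is accepted if and
only if it is in conflict with no previously accepted point. -/
def IsPacked (r adj : α → α → Prop) (F A : Set α) : Prop :=
  ∀ p, p ∈ A ↔ p ∈ F ∧ ∀ q ∈ A, r q p → ¬ adj p q

/-- Finite initial segments make the order well-founded on `F`: the number of predecessors strictly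
decreases along `r`. -/
theorem initial_induction {r : α → α → Prop} [IsStrictOrder α r] {F : Set α}
    (hfin : ∀ p ∈ F, {q | q ∈ F ∧ r q p}.Finite) {C : α → Prop}
    (h : ∀ p ∈ F, (∀ q ∈ F, r q p → C q) → C p) : ∀ p ∈ F, C p := by
  suffices H : ∀ n : ℕ, ∀ p ∈ F, {q | q ∈ F ∧ r q p}.ncard = n → C p from
    fun p hp => H _ p hp rfl
  intro n
  induction n using Nat.strong_induction_on with
  | _ n ih =>
    intro p hp hn
    refine h p hp fun q hq hqp => ih _ ?_ q hq rfl
    rw [← hn]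
    refine Set.ncard_lt_ncard ?_ (hfin p hp)
    refine ⟨fun x hx => ⟨hx.1, _root_.trans hx.2 hqp⟩, fun hsub => ?_⟩
    exact irrefl q (hsub ⟨hq, hqp⟩ : q ∈ F ∧ r q q).2

theorem IsPacked.subset {r adj : α → α → Prop} {F A : Set α} (hA : IsPacked r adj F A) :
    A ⊆ F := fun p hp => ((hA p).1 hp).1

/-- This is how packings are compared throughout: a set that satisfies the greedy rule for an input
is its accepted set, since acceptance depends on predecessors only. -/
theorem IsPacked.unique {r adj : α → α → Prop} [IsStrictOrder α r] {F A B : Set α}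
    (hfin : ∀ p ∈ F, {q | q ∈ F ∧ r q p}.Finite)
    (hA : IsPacked r adj F A) (hB : IsPacked r adj F B) : A = B := by
  have H : ∀ p ∈ F, (p ∈ A ↔ p ∈ B) := by
    refine initial_induction hfin fun p hp ih => ?_
    rw [hA p, hB p]
    refine and_congr_right fun _ => ⟨fun h q hq hqp => ?_, fun h q hq hqp => ?_⟩
    · exact h q ((ih q (hB.subset hq) hqp).2 hq) hqp
    · exact h q ((ih q (hA.subset hq) hqp).1 hq) hqp
  ext p
  exact ⟨fun h => (H p (hA.subset h)).1 h, fun h => (H p (hB.subset h)).2 h⟩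

theorem IsPacked.image {r adj : α → α → Prop} {r' adj' : β → β → Prop} {F A : Set α}
    (hA : IsPacked r adj F A) {c : α → β}
    (hr : ∀ p ∈ F, ∀ q ∈ F, (r' (c p) (c q) ↔ r p q))
    (hadj : ∀ p ∈ F, ∀ q ∈ F, p ≠ q → (adj' (c p) (c q) ↔ adj p q)) (hirr : ∀ p, ¬ r p p) :
    IsPacked r' adj' (c '' F) (c '' A) := by
  intro y
  constructor
  · rintro ⟨p, hp, rfl⟩
    refine ⟨⟨p, hA.subset hp, rfl⟩, ?_⟩
    rintro _ ⟨q, hq, rfl⟩ hqp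
    have h1 := (hr q (hA.subset hq) p (hA.subset hp)).1 hqp
    rw [hadj p (hA.subset hp) q (hA.subset hq) (by rintro rfl; exact hirr _ h1)]
    exact ((hA p).1 hp).2 q hq h1
  · rintro ⟨⟨p, hp, rfl⟩, h⟩
    refine ⟨p, (hA p).2 ⟨hp, fun q hq hqp => ?_⟩, rfl⟩
    rw [← hadj p hp q (hA.subset hq) (by rintro rfl; exact hirr _ hqp)]
    exact h _ ⟨q, hq, rfl⟩ ((hr q (hA.subset hq) p hp).2 hqp)

end Packing

/-! ### The listing order, and acceptance as the solution of the greedy rule. -/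

variable {d : ℕ} {S : Set (Space d)}

/-- The second components are compared first, ties are broken lexicographically. -/
def TimeLex {α β : Type*} [LinearOrder α] [LinearOrder β] (p q : (Fin d → α) × β) : Prop :=
  p.2 < q.2 ∨ (p.2 = q.2 ∧ toLex p.1 < toLex q.1)

instance {α β : Type*} [LinearOrder α] [LinearOrder β] :
    IsStrictOrder ((Fin d → α) × β) TimeLex where
  irrefl p h := by
    rcases h with h | h
    · exact lt_irrefl _ h
    · exact lt_irrefl _ h.2
  trans p q s h1 h2 := by
    rcases h1 with h1 | h1 <;> rcases h2 with h2 | h2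
    · exact Or.inl (h1.trans h2)
    · exact Or.inl (h2.1 ▸ h1)
    · exact Or.inl (h1.1 ▸ h2)
    · exact Or.inr ⟨h1.1.trans h2.1, h1.2.trans h2.2⟩

instance : IsStrictOrder (SpaceTime d) Precedes :=
  inferInstanceAs (IsStrictOrder (SpaceTime d) TimeLex)

theorem precedes_trichotomy {p q : SpaceTime d} (h : p ≠ q) : Precedes p q ∨ Precedes q p := by
  rcases lt_trichotomy p.2 q.2 with h2 | h2 | h2
  · exact Or.inl (Or.inl h2)
  · rcases lt_trichotomy (toLex p.1) (toLex q.1) with h1 | h1 | h1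
    · exact Or.inl (Or.inr ⟨h2, h1⟩)
    · exact absurd (Prod.ext (toLex_inj.1 h1) h2) h
    · exact Or.inr (Or.inr ⟨h2.symm, h1⟩)
  · exact Or.inr (Or.inl h2)

theorem Precedes.time_le {p q : SpaceTime d} (h : Precedes p q) : p.2 ≤ q.2 := by
  rcases h with h | h
  · exact h.le
  · exact h.1.le

/-- Every point of `X` has only finitely many points of `X` listed before it. -/
def FiniteInitial (X : Set (SpaceTime d)) : Prop :=
  ∀ p ∈ X, {q | q ∈ X ∧ Precedes q p}.Finite

theorem FiniteInitial.mono {X Y : Set (SpaceTime d)} (hX : FiniteInitial X) (h : Y ⊆ X) :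
    FiniteInitial Y := fun p hp => (hX p (h hp)).subset fun _ hq => ⟨h hq.1, hq.2⟩

theorem acceptedAmongFirst_mem {X : Set (SpaceTime d)} {n : ℕ} {p : SpaceTime d} :
    p ∈ acceptedAmongFirst S X n ↔ ∃ k < n, p ∈ X ∧ {q | q ∈ X ∧ Precedes q p}.encard = k ∧
      ∀ q ∈ acceptedAmongFirst S X k, ¬ Adjacent S p q := by
  induction n with
  | zero => simp [acceptedAmongFirst]
  | succ n ih =>
    rw [acceptedAmongFirst, mem_union, ih]
    constructor
    · rintro (⟨k, hk, h⟩ | h)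
      · exact ⟨k, by omega, h⟩
      · exact ⟨n, by omega, h⟩
    · rintro ⟨k, hk, h⟩
      rcases Nat.lt_succ_iff_lt_or_eq.1 hk with hk | rfl
      · exact Or.inl ⟨k, hk, h⟩
      · exact Or.inr h

theorem mem_accepted {X : Set (SpaceTime d)} {p : SpaceTime d} :
    p ∈ accepted S X ↔ ∃ k : ℕ, p ∈ X ∧ {q | q ∈ X ∧ Precedes q p}.encard = k ∧
      ∀ q ∈ acceptedAmongFirst S X k, ¬ Adjacent S p q := by
  rw [accepted, mem_iUnion]
  constructor
  · rintro ⟨n, hn⟩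
    obtain ⟨k, -, h⟩ := acceptedAmongFirst_mem.1 hn
    exact ⟨k, h⟩
  · rintro ⟨k, h⟩
    exact ⟨k + 1, acceptedAmongFirst_mem.2 ⟨k, by omega, h⟩⟩

theorem accepted_subset (X : Set (SpaceTime d)) : accepted S X ⊆ X := fun p hp => by
  obtain ⟨k, h, -⟩ := mem_accepted.1 hp
  exact h

/-- A point with exactly `k` predecessors is decided at stage `k + 1` and never reconsidered. -/
theorem mem_acceptedAmongFirst_iff {X : Set (SpaceTime d)} {n : ℕ} {p : SpaceTime d} :
    p ∈ acceptedAmongFirst S X n ↔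
      p ∈ accepted S X ∧ {q | q ∈ X ∧ Precedes q p}.encard < n := by
  rw [acceptedAmongFirst_mem, mem_accepted]
  constructor
  · rintro ⟨k, hk, h⟩
    exact ⟨⟨k, h⟩, by rw [h.2.1]; exact_mod_cast hk⟩
  · rintro ⟨⟨k, h⟩, hn⟩
    rw [h.2.1] at hn
    exact ⟨k, by exact_mod_cast hn, h⟩

theorem encard_initial_lt_iff {X : Set (SpaceTime d)} (hX : FiniteInitial X) {p q : SpaceTime d}
    (hp : p ∈ X) (hq : q ∈ X) :
    {s | s ∈ X ∧ Precedes s q}.encard < {s | s ∈ X ∧ Precedes s p}.encard ↔ Precedes q p := by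
  have H : ∀ p ∈ X, ∀ q ∈ X, Precedes q p →
      {s | s ∈ X ∧ Precedes s q}.encard < {s | s ∈ X ∧ Precedes s p}.encard := by
    intro p hp q hq h
    refine (hX q hq).encard_lt_encard
      ⟨fun s hs => ⟨hs.1, _root_.trans hs.2 h⟩, fun hsub => ?_⟩
    exact irrefl (r := Precedes) q (hsub ⟨hq, h⟩ : q ∈ X ∧ Precedes q q).2
  refine ⟨fun h => ?_, H p hp q hq⟩
  by_contra hn
  by_cases hpq : p = q
  · subst hpq; exact lt_irrefl _ h
  · rcases precedes_trichotomy hpq with h1 | h1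
    · exact absurd (H q hq p hp h1) (not_lt.2 h.le)
    · exact hn h1

/-- Rank is strictly increasing along the listing order, so the points accepted before the stage of
`p` are the accepted points that precede `p`. This replaces the recursion by the greedy rule. -/
theorem isPacked_accepted {X : Set (SpaceTime d)} (hX : FiniteInitial X) :
    IsPacked Precedes (Adjacent S) X (accepted S X) := by
  intro p
  rw [mem_accepted]
  constructor
  · rintro ⟨k, hp, hk, h⟩
    refine ⟨hp, fun q hq hqp => h q ?_⟩
    rw [mem_acceptedAmongFirst_iff, ← hk, encard_initial_lt_iff hX hp (accepted_subset X hq)]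
    exact ⟨hq, hqp⟩
  · rintro ⟨hp, h⟩
    obtain ⟨k, hk⟩ := ENat.ne_top_iff_exists.1 (hX p hp).encard_lt_top.ne
    refine ⟨k, hp, hk.symm, fun q hq => ?_⟩
    have hqa := (mem_acceptedAmongFirst_iff.1 hq).1
    rw [mem_acceptedAmongFirst_iff, hk,
      encard_initial_lt_iff hX hp (accepted_subset X hqa)] at hq
    exact h q hq.1 hq.2

theorem Adjacent.symm {p q : SpaceTime d} (h : Adjacent S p q) : Adjacent S q p := by
  rwa [Adjacent, inter_comm]

theorem accepted_pairwise {X : Set (SpaceTime d)} (hX : FiniteInitial X) {p q : SpaceTime d}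
    (hp : p ∈ accepted S X) (hq : q ∈ accepted S X) (hpq : p ≠ q) : ¬ Adjacent S p q := by
  rcases precedes_trichotomy hpq with h | h
  · exact fun hadj => ((isPacked_accepted hX q).1 hq).2 p hp h hadj.symm
  · exact ((isPacked_accepted hX p).1 hp).2 q hq h

/-- Points that arrive after time `T` do not influence the acceptance of those that arrive
before. -/
theorem accepted_inter_time {X : Set (SpaceTime d)} (hX : FiniteInitial X) (T : ℝ≥0) :
    accepted S (X ∩ {p | p.2 < T}) = accepted S X ∩ {p | p.2 < T} := by
  have hF := hX.mono (inter_subset_left : X ∩ {p | p.2 < T} ⊆ X)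
  refine IsPacked.unique hF (isPacked_accepted hF) fun p => ?_
  constructor
  · rintro ⟨hp, hT⟩
    exact ⟨⟨accepted_subset X hp, hT⟩,
      fun q hq hqp => ((isPacked_accepted hX p).1 hp).2 q hq.1 hqp⟩
  · rintro ⟨⟨hp, hT⟩, h⟩
    exact ⟨(isPacked_accepted hX p).2
      ⟨hp, fun q hq hqp => h q ⟨hq, lt_of_le_of_lt hqp.time_le hT⟩ hqp⟩, hT⟩

/-- `X` is locally finite in time. -/
def TimeFinite (X : Set (SpaceTime d)) : Prop := ∀ T : ℕ, (X ∩ {p | p.2 < T}).Finite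

theorem TimeFinite.mono {X Y : Set (SpaceTime d)} (hX : TimeFinite X) (h : Y ⊆ X) :
    TimeFinite Y := fun T => (hX T).subset (inter_subset_inter_left _ h)

theorem TimeFinite.finiteInitial {X : Set (SpaceTime d)} (hX : TimeFinite X) :
    FiniteInitial X := fun p _ => by
  obtain ⟨T, hT⟩ := exists_nat_gt p.2
  exact (hX T).subset fun q hq => ⟨hq.1, lt_of_le_of_lt hq.2.time_le hT⟩

/-! ### Counts of a Poisson process and independence over disjoint regions. -/

section CountSigma

variable {Ω α : Type*} [MeasurableSpace α]

/-- The `σ`-algebra generated by the numbers of points of `X` in the measurable subsets of `D`. -/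
noncomputable abbrev countSigma (X : Ω → Set α) (D : Set α) : MeasurableSpace Ω :=
  ⨆ B : {B : Set α // MeasurableSet B ∧ B ⊆ D},
    MeasurableSpace.comap (fun ω => (X ω ∩ B.1).encard) inferInstance

variable {X : Ω → Set α}

theorem measurable_count_countSigma {D B : Set α} (hB : MeasurableSet B) (hBD : B ⊆ D) :
    Measurable[countSigma X D] fun ω => (X ω ∩ B).encard :=
  Measurable.of_comap_le (le_iSup (fun B : {B : Set α // MeasurableSet B ∧ B ⊆ D} =>
    MeasurableSpace.comap (fun ω => (X ω ∩ B.1).encard) inferInstance) ⟨B, hB, hBD⟩)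

theorem countSigma_mono {D D' : Set α} (h : D ⊆ D') : countSigma X D ≤ countSigma X D' :=
  iSup_le fun B => le_iSup (fun B : {B : Set α // MeasurableSet B ∧ B ⊆ D'} =>
    MeasurableSpace.comap (fun ω => (X ω ∩ B.1).encard) inferInstance) ⟨B.1, B.2.1, B.2.2.trans h⟩

variable [MeasurableSpace Ω] {ν : Measure α} {P : Measure Ω}

theorem IsPoissonProcess.countSigma_le (hX : IsPoissonProcess X ν P) (D : Set α) :
    countSigma X D ≤ (inferInstance : MeasurableSpace Ω) :=
  iSup_le fun B => (hX.measurable_count B.1 B.2.1).comap_le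

theorem IsPoissonProcess.indep_count_fintype (hX : IsPoissonProcess X ν P) {ι : Type*} [Fintype ι]
    (B : ι → Set α) (hB : ∀ i, MeasurableSet (B i))
    (hd : Pairwise fun i j => Disjoint (B i) (B j)) :
    iIndepFun (fun i ω => (X ω ∩ B i).encard) P := by
  have e := Fintype.equivFin ι
  have h := hX.indep_count _ (fun i => B (e.symm i)) (fun i => hB _)
    (fun i j hij => hd (e.symm.injective.ne hij))
  have h2 := h.precomp e.injective
  simpa using h2

theorem IsPoissonProcess.indep_finset [IsProbabilityMeasure P] (hX : IsPoissonProcess X ν P)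
    {D D' : Set α} (hDD' : Disjoint D D')
    (s : Finset {B : Set α // MeasurableSet B ∧ B ⊆ D})
    (s' : Finset {B : Set α // MeasurableSet B ∧ B ⊆ D'}) :
    Indep (⨆ B ∈ s, MeasurableSpace.comap (fun ω => (X ω ∩ B.1).encard) inferInstance)
      (⨆ B ∈ s', MeasurableSpace.comap (fun ω => (X ω ∩ B.1).encard) inferInstance) P := by
  classical
  -- Each point records which of the finitely many sets contain it. The fibres of `c` are disjoint,
  -- so their counts are independent, and every given count is a sum of fibre counts.
  let c : α → (s → Bool) × (s' → Bool) :=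
    fun x => (fun B => decide (x ∈ B.1.1), fun B => decide (x ∈ B.1.1))
  have hc : Measurable c := by
    refine Measurable.prodMk (measurable_pi_iff.2 fun B => ?_) (measurable_pi_iff.2 fun B => ?_)
    · exact measurable_to_bool (by simpa [preimage] using B.1.2.1)
    · exact measurable_to_bool (by simpa [preimage] using B.1.2.1)
  have hind := hX.indep_count_fintype (fun i => c ⁻¹' {i}) (fun i => hc (measurableSet_singleton i))
    (fun i j hij => Disjoint.preimage c (disjoint_singleton.2 hij))
  have hcount : ∀ U : Set ((s → Bool) × (s' → Bool)), ∀ ω,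
      (X ω ∩ c ⁻¹' U).encard = ∑ i : U, (X ω ∩ c ⁻¹' {i.1}).encard := by
    intro U ω
    rw [← finsum_eq_sum_of_fintype, ← Set.encard_iUnion_of_finite]
    · congr 1; ext x; simp
    · intro i j hij
      refine Disjoint.mono inter_subset_right inter_subset_right
        (Disjoint.preimage c (disjoint_singleton.2 (Subtype.coe_injective.ne hij)))
  let m : (s → Bool) × (s' → Bool) → MeasurableSpace Ω :=
    fun i => MeasurableSpace.comap (fun ω => (X ω ∩ c ⁻¹' {i}).encard) inferInstance
  have key : ∀ (U V : Set ((s → Bool) × (s' → Bool))) (B : Set α), B = c ⁻¹' U → U ⊆ V →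
      MeasurableSpace.comap (fun ω => (X ω ∩ B).encard) inferInstance ≤ ⨆ i ∈ V, m i := by
    rintro U V _ rfl hUV
    refine Measurable.comap_le ?_
    simp_rw [hcount U]
    refine Finset.measurable_sum _ fun i _ => ?_
    exact Measurable.of_comap_le (le_iSup₂_of_le (f := fun i (_ : i ∈ V) => m i) i.1 (hUV i.2) le_rfl)
  -- Since `D` and `D'` are disjoint, sets in `D` use only fibres outside all sets in `D'`. The two
  -- families of counts thus involve disjoint sets of fibres.
  have hdisj : Disjoint {i : (s → Bool) × (s' → Bool) | ∃ B, i.1 B = true ∧ ∀ B, i.2 B = false}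
      {i | ∃ B, i.2 B = true} := by
    rw [Set.disjoint_left]
    rintro i ⟨B, -, h⟩ ⟨B', h'⟩
    simp [h B'] at h'
  have := indep_iSup_of_disjoint
    (fun i => (hX.measurable_count _ (hc (measurableSet_singleton i))).comap_le)
    (m := m) hind hdisj
  refine indep_of_indep_of_le_left (indep_of_indep_of_le_right this ?_) ?_
  · refine iSup₂_le fun B hB => key {i | i.2 ⟨B, hB⟩ = true} _ _ ?_ ?_
    · ext x; simp [c]
    · exact fun i hi => ⟨_, hi⟩
  · refine iSup₂_le fun B hB => key {i | i.1 ⟨B, hB⟩ = true ∧ ∀ B, i.2 B = false} _ _ ?_ ?_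
    · ext x
      simp only [c, mem_preimage, mem_ofPred_eq, decide_eq_true_eq, decide_eq_false_iff_not]
      exact ⟨fun hx => ⟨hx, fun B' hx' => hDD'.le_bot ⟨B.2.2 hx, B'.1.2.2 hx'⟩⟩, fun hx => hx.1⟩
    · exact fun i hi => ⟨_, hi.1, hi.2⟩

/-- The restrictions of a Poisson process to disjoint sets are independent. -/
theorem IsPoissonProcess.indep_countSigma [IsProbabilityMeasure P] (hX : IsPoissonProcess X ν P)
    {D D' : Set α} (hDD' : Disjoint D D') : Indep (countSigma X D) (countSigma X D') P := by
  have hdir : ∀ D : Set α, countSigma X D =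
      ⨆ s : Finset {B : Set α // MeasurableSet B ∧ B ⊆ D},
        ⨆ B ∈ s, MeasurableSpace.comap (fun ω => (X ω ∩ B.1).encard) inferInstance := by
    intro D
    rw [countSigma, iSup_eq_iSup_finset]
  have hle : ∀ (D : Set α) (s : Finset {B : Set α // MeasurableSet B ∧ B ⊆ D}),
      ⨆ B ∈ s, MeasurableSpace.comap (fun ω => (X ω ∩ B.1).encard) inferInstance ≤
        (inferInstance : MeasurableSpace Ω) :=
    fun D s => iSup₂_le fun B _ => (hX.measurable_count B.1 B.2.1).comap_le
  have hmono : ∀ D : Set α, Monotone fun s : Finset {B : Set α // MeasurableSet B ∧ B ⊆ D} =>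
      ⨆ B ∈ s, MeasurableSpace.comap (fun ω => (X ω ∩ B.1).encard) inferInstance := by
    classical
    exact fun D s t hst => biSup_mono fun B hB => hst hB
  classical
  rw [hdir D]
  -- The finite case extends to all test sets because the σ-algebras of finite subfamilies are
  -- directed, once on each side.
  refine indep_iSup_of_monotone (fun s => Indep.symm ?_) (hle D) (hX.countSigma_le D') (hmono D)
  rw [hdir D']
  exact indep_iSup_of_monotone (fun s' => (hX.indep_finset hDD' s s').symm) (hle D') (hle D s)
    (hmono D')

theorem IsPoissonProcess.integral_mul [IsProbabilityMeasure P] (hX : IsPoissonProcess X ν P)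
    {D D' : Set α} (hDD' : Disjoint D D') {f g : Ω → ℝ} (hf : Measurable[countSigma X D] f)
    (hg : Measurable[countSigma X D'] g) : ∫ ω, f ω * g ω ∂P = (∫ ω, f ω ∂P) * ∫ ω, g ω ∂P := by
  have h : IndepFun f g P :=
    indep_of_indep_of_le_left (indep_of_indep_of_le_right (hX.indep_countSigma hDD') hg.comap_le)
      hf.comap_le
  exact h.integral_fun_mul_eq_mul_integral
    (hf.mono (hX.countSigma_le D) le_rfl).aestronglyMeasurable
    (hg.mono (hX.countSigma_le D') le_rfl).aestronglyMeasurable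

/-- A Poisson process has almost surely finitely many points in a set of finite intensity. -/
theorem IsPoissonProcess.ae_finite (hX : IsPoissonProcess X ν P) {B : Set α}
    (hB : MeasurableSet B) (hν : ν B ≠ ∞) : ∀ᵐ ω ∂P, (X ω ∩ B).Finite := by
  have h := hX.map_count B hB hν
  have h2 : ∀ᵐ n ∂(P.map fun ω => (X ω ∩ B).encard), n < ⊤ := by
    rw [h, ae_map_iff (by fun_prop) (MeasurableSet.of_discrete)]
    exact Eventually.of_forall fun n => ENat.natCast_lt_top n
  filter_upwards [ae_of_ae_map (hX.measurable_count B hB).aemeasurable h2] with ω hω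
  exact Set.encard_lt_top_iff.1 hω

theorem IsPoissonProcess.count_eq (hX : IsPoissonProcess X ν P) {B : Set α}
    (hB : MeasurableSet B) (hν : ν B ≠ ∞) (n : ℕ) :
    P {ω | (X ω ∩ B).encard = n} =
      ENNReal.ofReal (Real.exp (-(ν B).toNNReal) * (ν B).toNNReal ^ n / n.factorial) := by
  have h := congrArg (fun m => m {(n : ℕ∞)}) (hX.map_count B hB hν)
  beta_reduce at h
  rw [Measure.map_apply (hX.measurable_count B hB) (measurableSet_singleton _),
    Measure.map_apply (by fun_prop) (measurableSet_singleton _)] at h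
  have e : (Nat.cast ⁻¹' {(n : ℕ∞)} : Set ℕ) = {n} := by ext; simp
  rw [e, poissonMeasure_singleton] at h
  exact h

end CountSigma

/-! ### Packing bounds, and measurability by discretization. -/

section Discretization

variable {d : ℕ} {S : Set (Space d)}

theorem adjacent_iff {p q : SpaceTime d} : Adjacent S p q ↔ p.1 - q.1 ∈ S - S := by
  rw [Adjacent, Set.mem_sub]
  constructor
  · rintro ⟨_, ⟨s, hs, rfl⟩, ⟨s', hs', h⟩⟩
    refine ⟨s', hs', s, hs, ?_⟩
    simp only [vadd_eq_add] at h
    rw [sub_eq_sub_iff_add_eq_add, ← h, add_comm]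
  · rintro ⟨s', hs', s, hs, h⟩
    refine ⟨p.1 + s, ⟨s, hs, rfl⟩, ⟨s', hs', ?_⟩⟩
    simp only [vadd_eq_add]
    rw [sub_eq_sub_iff_add_eq_add] at h
    rw [← h, add_comm]

theorem IsSolid.isCompact (hS : IsSolid S) : IsCompact S :=
  Metric.isCompact_of_isClosed_isBounded hS.closed hS.bounded

theorem IsSolid.isCompact_sub (hS : IsSolid S) : IsCompact (S - S) := by
  rw [sub_eq_add_neg]
  exact hS.isCompact.add hS.isCompact.neg

theorem IsSolid.exists_ball_subset (hS : IsSolid S) : ∃ r > 0, Metric.ball 0 r ⊆ S - S := by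
  obtain ⟨x, hx⟩ := hS.interior_nonempty
  obtain ⟨r, hr, h⟩ := Metric.isOpen_iff.1 isOpen_interior x hx
  refine ⟨r, hr, fun y hy => ?_⟩
  rw [Set.mem_sub]
  refine ⟨x + y, interior_subset (h ?_), x, interior_subset hx, by abel⟩
  simpa using hy

/-- Only a bounded number of solids can be packed in a bounded region. -/
theorem IsSolid.exists_packing_bound (hS : IsSolid S) {B : Set (Space d)}
    (hB : Bornology.IsBounded B) : ∃ C : ℕ, ∀ A : Set (SpaceTime d), A ⊆ cylinder B →
      (∀ p ∈ A, ∀ q ∈ A, p ≠ q → ¬ Adjacent S p q) → A.encard ≤ C := by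
  obtain ⟨r, hr, hball⟩ := hS.exists_ball_subset
  obtain ⟨t, -, ht, hBt⟩ := Metric.finite_approx_of_totallyBounded
    (TotallyBounded.subset subset_closure hB.isCompact_closure.totallyBounded) (r / 2) (half_pos hr)
  refine ⟨t.ncard, fun A hA hpair => ?_⟩
  have hex : ∀ p ∈ A, ∃ y ∈ t, p.1 ∈ Metric.ball y (r / 2) := fun p hp => by
    simpa using hBt (hA hp).1
  choose! f hft hf using hex
  have hinj : InjOn f A := by
    intro p hp q hq hpq
    by_contra hne
    refine hpair p hp q hq hne (adjacent_iff.2 (hball ?_))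
    have h1 := hf p hp
    have h2 := hf q hq
    rw [← hpq] at h2
    rw [Metric.mem_ball, dist_zero_right, ← dist_eq_norm]
    rw [Metric.mem_ball] at h1 h2
    calc dist p.1 q.1 ≤ dist p.1 (f p) + dist q.1 (f p) := dist_triangle_right _ _ _
      _ < r := by linarith
  rw [ht.cast_ncard_eq]
  exact Set.encard_le_encard_of_injOn hft hinj

theorem IsSolid.accepted_encard_le (hS : IsSolid S) {B : Set (Space d)}
    (hB : Bornology.IsBounded B) : ∃ C : ℕ, ∀ X : Set (SpaceTime d), X ⊆ cylinder B →
      FiniteInitial X → (accepted S X).encard ≤ C := by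
  obtain ⟨C, hC⟩ := hS.exists_packing_bound hB
  exact ⟨C, fun X hXB hX => hC _ ((accepted_subset X).trans hXB)
    fun p hp q hq hpq => accepted_pairwise hX hp hq hpq⟩

/-- The index of the cell of side `1 / n` that contains `p`. -/
noncomputable def cellIndex (n : ℕ) (p : SpaceTime d) : (Fin d → ℤ) × ℕ :=
  (fun i => ⌊(n : ℝ) * p.1 i⌋, ⌊(n : ℝ≥0) * p.2⌋₊)

/-- Two cells are adjacent if they contain adjacent points. -/
def CellAdjacent (S : Set (Space d)) (n : ℕ) (c c' : (Fin d → ℤ) × ℕ) : Prop :=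
  ∃ p q : SpaceTime d, cellIndex n p = c ∧ cellIndex n q = c' ∧ Adjacent S p q

theorem eventually_floor_lt {x y : ℝ} (h : x < y) :
    ∀ᶠ n : ℕ in atTop, ⌊(n : ℝ) * x⌋ < ⌊(n : ℝ) * y⌋ := by
  obtain ⟨N, hN⟩ := exists_nat_gt (1 / (y - x))
  filter_upwards [eventually_ge_atTop N] with n hn
  have h1 : 1 < (n : ℝ) * (y - x) := by
    rw [← div_lt_iff₀ (by linarith)]
    exact hN.trans_le (by exact_mod_cast hn)
  rw [Int.lt_iff_add_one_le, Int.le_floor]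
  push_cast
  have := Int.floor_le ((n : ℝ) * x)
  nlinarith

theorem eventually_nat_floor_lt {x y : ℝ≥0} (h : x < y) :
    ∀ᶠ n : ℕ in atTop, ⌊(n : ℝ≥0) * x⌋₊ < ⌊(n : ℝ≥0) * y⌋₊ := by
  have h' : (x : ℝ) < y := NNReal.coe_lt_coe.2 h
  obtain ⟨N, hN⟩ := exists_nat_gt (1 / ((y : ℝ) - x))
  filter_upwards [eventually_ge_atTop N] with n hn
  have h1 : 1 < (n : ℝ) * (y - x) := by
    rw [← div_lt_iff₀ (by linarith)]
    exact hN.trans_le (by exact_mod_cast hn)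
  rw [← Nat.succ_le_iff]
  refine Nat.le_floor ?_
  have h2 : ((⌊(n : ℝ≥0) * x⌋₊ : ℝ≥0) : ℝ) ≤ ((n * x : ℝ≥0) : ℝ) :=
    NNReal.coe_le_coe.2 (Nat.floor_le (by positivity))
  rw [← NNReal.coe_le_coe]
  push_cast at h2 ⊢
  nlinarith

/-- Strict inequalities survive rounding on a fine grid, and the equalities preceding them in the
comparison survive on every grid. -/
theorem eventually_timeLex {p q : SpaceTime d} (h : Precedes p q) :
    ∀ᶠ n in atTop, TimeLex (cellIndex n p) (cellIndex n q) := by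
  rcases h with h | ⟨h2, i, hi, hlt⟩
  · filter_upwards [eventually_nat_floor_lt h] with n hn
    exact Or.inl hn
  · filter_upwards [eventually_floor_lt hlt] with n hn
    refine Or.inr ⟨by simp [cellIndex, h2], i, fun j hj => ?_, hn⟩
    have hj' : p.1 j = q.1 j := hi j hj
    exact congrArg (fun x : ℝ => ⌊(n : ℝ) * x⌋) hj'

theorem dist_le_of_cellIndex_eq {n : ℕ} (hn : 0 < n) {p q : SpaceTime d}
    (h : cellIndex n p = cellIndex n q) : ‖p.1 - q.1‖ ≤ 1 / n := by
  have hn' : (0 : ℝ) < n := by exact_mod_cast hn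
  rw [pi_norm_le_iff_of_nonneg (by positivity)]
  intro i
  have h1 := congrFun (congrArg Prod.fst h) i
  have h2 := Int.abs_sub_lt_one_of_floor_eq_floor h1
  rw [← mul_sub, abs_mul, abs_of_pos hn'] at h2
  rw [le_div_iff₀ hn', mul_comm, Pi.sub_apply, Real.norm_eq_abs]
  exact h2.le

/-- As `S - S` is closed, a difference outside it stays outside under small displacements. -/
theorem eventually_not_cellAdjacent (hS : IsSolid S) {p q : SpaceTime d}
    (h : ¬ Adjacent S p q) :
    ∀ᶠ n in atTop, ¬ CellAdjacent S n (cellIndex n p) (cellIndex n q) := by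
  rw [adjacent_iff] at h
  obtain ⟨ε, hε, hball⟩ := Metric.isOpen_iff.1 hS.isCompact_sub.isClosed.isOpen_compl _ h
  obtain ⟨N, hN⟩ := exists_nat_gt (2 / ε)
  filter_upwards [eventually_ge_atTop N, eventually_gt_atTop 0] with n hn hn0
  rintro ⟨p', q', hp, hq, hadj⟩
  have hn' : (0 : ℝ) < n := by exact_mod_cast hn0
  have h1 := dist_le_of_cellIndex_eq hn0 hp
  have h2 := dist_le_of_cellIndex_eq hn0 hq
  refine hball (a := p'.1 - q'.1) ?_ (adjacent_iff.1 hadj)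
  rw [Metric.mem_ball, dist_eq_norm]
  calc ‖p'.1 - q'.1 - (p.1 - q.1)‖ = ‖(p'.1 - p.1) - (q'.1 - q.1)‖ := by congr 1; abel
    _ ≤ 1 / n + 1 / n := (norm_sub_le _ _).trans (add_le_add h1 h2)
    _ = 2 / n := by ring
    _ < ε := by
      rw [div_lt_iff₀ hn', mul_comm, ← div_lt_iff₀ hε]
      exact hN.trans_le (by exact_mod_cast hn)

open Classical in
/-- The number of cells accepted when the occupied cells are packed in their natural order. -/
noncomputable def cellCount (S : Set (Space d)) (n : ℕ) (O : Set ((Fin d → ℤ) × ℕ)) : ℕ :=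
  -- For finite `O` the chosen packing is unique; the value 0 is irrelevant in the limit.
  if h : ∃ A, IsPacked TimeLex (CellAdjacent S n) O A then h.choose.ncard else 0

/-- On a fine grid `cellIndex` is injective on `F` and preserves order and adjacency, so it carries
one packing to the other. -/
theorem eventually_cellCount (hS : IsSolid S) {F : Set (SpaceTime d)} (hF : F.Finite) :
    ∀ᶠ n in atTop, cellCount S n (cellIndex n '' F) = (accepted S F).ncard := by
  have hord : ∀ᶠ n in atTop, ∀ p ∈ F, ∀ q ∈ F, Precedes p q →
      TimeLex (cellIndex n p) (cellIndex n q) := by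
    simp only [hF.eventually_all, eventually_imp_distrib_left]
    exact fun p _ q _ h => eventually_timeLex h
  have hadj : ∀ᶠ n in atTop, ∀ p ∈ F, ∀ q ∈ F, ¬ Adjacent S p q →
      ¬ CellAdjacent S n (cellIndex n p) (cellIndex n q) := by
    simp only [hF.eventually_all, eventually_imp_distrib_left]
    exact fun p _ q _ h => eventually_not_cellAdjacent hS h
  filter_upwards [hord, hadj] with n hord hadj
  have hinj : InjOn (cellIndex n) F := by
    intro p hp q hq hpq
    by_contra hne
    rcases precedes_trichotomy hne with h | h
    · have := hord p hp q hq h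
      rw [hpq] at this
      exact irrefl _ this
    · have := hord q hq p hp h
      rw [hpq] at this
      exact irrefl _ this
  have hFI : FiniteInitial F := fun p _ => hF.subset fun q hq => hq.1
  have hpack : IsPacked TimeLex (CellAdjacent S n) (cellIndex n '' F)
      (cellIndex n '' accepted S F) := by
    refine (isPacked_accepted hFI).image (fun p hp q hq => ⟨fun h => ?_, hord p hp q hq⟩)
      (fun p hp q hq hpq => ⟨fun h => ?_, fun h => ⟨p, q, rfl, rfl, h⟩⟩)
      (fun p => irrefl (r := Precedes) p)
    · by_cases hpq : p = q
      · subst hpq; exact absurd h (irrefl _)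
      · rcases precedes_trichotomy hpq with h' | h'
        · exact h'
        · exact absurd (_root_.trans h (hord q hq p hp h')) (irrefl _)
    · by_contra h'
      exact hadj p hp q hq h' h
  have hex : ∃ A, IsPacked TimeLex (CellAdjacent S n) (cellIndex n '' F) A := ⟨_, hpack⟩
  rw [cellCount, dif_pos hex, IsPacked.unique
    (fun p _ => (hF.image _).subset fun q hq => hq.1) hex.choose_spec hpack]
  exact (hinj.mono (accepted_subset F)).ncard_image

theorem measurable_cellIndex (n : ℕ) : Measurable (cellIndex n : SpaceTime d → _) := by
  unfold cellIndex
  fun_prop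

theorem finite_cellIndex_image (n : ℕ) {B : Set (Space d)} (hB : Bornology.IsBounded B) (T : ℝ≥0) :
    (cellIndex n '' (B ×ˢ Iio T)).Finite := by
  obtain ⟨M, hM⟩ := hB.exists_norm_le
  refine ((Set.finite_Icc (fun _ : Fin d => ⌊(n : ℝ) * (-M)⌋) fun _ => ⌊(n : ℝ) * M⌋).prod
    (Set.finite_Iic ⌊(n : ℝ≥0) * T⌋₊)).subset ?_
  rintro _ ⟨p, ⟨hp, hT⟩, rfl⟩
  have h : ∀ i, |p.1 i| ≤ M := fun i => (norm_le_pi_norm p.1 i).trans (hM _ hp)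
  refine ⟨⟨fun i => ?_, fun i => ?_⟩, ?_⟩
  · exact Int.floor_mono (mul_le_mul_of_nonneg_left (abs_le.1 (h i)).1 (by positivity))
  · exact Int.floor_mono (mul_le_mul_of_nonneg_left (abs_le.1 (h i)).2 (by positivity))
  · exact Nat.floor_mono (mul_le_mul_of_nonneg_left (le_of_lt hT) (by positivity))

theorem measurable_cellCount {Ω : Type*} {X : Ω → Set (SpaceTime d)} (n : ℕ) {B : Set (Space d)}
    (hB : Bornology.IsBounded B) {T : ℝ≥0} {D : Set (SpaceTime d)} (hD : MeasurableSet D)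
    (hDB : D ⊆ B ×ˢ Iio T) :
    Measurable[countSigma X D] fun ω => cellCount S n (cellIndex n '' (X ω ∩ D)) := by
  -- Only finitely many cells matter, so the value is a function of finitely many counts on a
  -- discrete space.
  let J := cellIndex n '' (B ×ˢ Iio T)
  have : Finite J := finite_cellIndex_image n hB T
  let f : Ω → J → ℕ∞ := fun ω c => (X ω ∩ (D ∩ cellIndex n ⁻¹' {c.1})).encard
  have hf : Measurable[countSigma X D] f := by
    let _ := countSigma X D
    refine measurable_pi_iff.2 fun c => measurable_count_countSigma
      (hD.inter (measurable_cellIndex n (measurableSet_singleton _))) inter_subset_left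
  have h : ∀ ω, cellIndex n '' (X ω ∩ D) = Subtype.val '' {c | f ω c ≠ 0} := by
    intro ω
    ext c
    simp only [mem_image, mem_ofPred_eq, Subtype.exists, exists_and_right, exists_eq_right, f,
      Set.encard_ne_zero]
    constructor
    · rintro ⟨p, hp, rfl⟩
      exact ⟨⟨p, hDB hp.2, rfl⟩, p, hp.1, hp.2, rfl⟩
    · rintro ⟨-, p, hp, hpD, hc⟩
      exact ⟨p, ⟨hp, hpD⟩, hc⟩
  simp_rw [h]
  exact (Measurable.of_discrete (f := fun g : J → ℕ∞ =>
    cellCount S n (Subtype.val '' {c | g c ≠ 0}))).comp hf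

theorem measurable_toReal_limsup_limsup {Ω : Type*} [MeasurableSpace Ω] {f : ℕ → ℕ → Ω → ℕ}
    (hf : ∀ T n, Measurable (f T n)) : Measurable fun ω =>
      (limsup (fun T => limsup (fun n => (f T n ω : ℝ≥0∞)) atTop) atTop).toReal :=
  ENNReal.measurable_toReal.comp <| Measurable.limsup fun T => Measurable.limsup fun n =>
    measurable_from_top.comp (hf T n)

theorem limsup_of_eventually_eq {f : ℕ → ℝ≥0∞} {a : ℝ≥0∞} (h : ∀ᶠ n in atTop, f n = a) :
    limsup f atTop = a := by
  rw [limsup_congr h, limsup_const]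

theorem timeMeasure_Iio (T : ℝ≥0) : timeMeasure (Iio T) = T := by
  have h := (MeasurableEmbedding.subtype_coe (s := {r : ℝ | 0 ≤ r})
    measurableSet_Ici).comap_apply volume (Iio T)
  have : Subtype.val '' (Iio T : Set ℝ≥0) = Ico 0 (T : ℝ) := by
    ext x
    constructor
    · rintro ⟨y, hy, rfl⟩
      exact ⟨y.2, hy⟩
    · rintro ⟨h0, h1⟩
      exact ⟨⟨x, h0⟩, h1, rfl⟩
  refine h.trans ?_
  erw [this]
  simp

instance : SigmaFinite timeMeasure :=
  ⟨⟨{ set := fun n => Iio (n : ℝ≥0)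
      set_mem := fun _ => trivial
      finite := fun n => by rw [timeMeasure_Iio]; exact ENNReal.coe_lt_top
      spanning := by
        ext x
        simpa using exists_nat_gt x }⟩⟩

theorem intensity_prod_Iio (B : Set (Space d)) (T : ℝ≥0) :
    intensity d (B ×ˢ Iio T) = volume B * T := by
  rw [intensity, Measure.prod_prod, timeMeasure_Iio]

variable {Ω : Type*} [MeasurableSpace Ω] {P : Measure Ω} {X : Ω → Set (SpaceTime d)}

theorem IsPoissonProcess.ae_timeFinite (hX : IsPoissonProcess X (intensity d) P)
    {B : Set (Space d)} (hB : Bornology.IsBounded B) :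
    ∀ᵐ ω ∂P, TimeFinite (X ω ∩ cylinder B) := by
  obtain ⟨M, hM⟩ := hB.subset_closedBall 0
  refine ae_all_iff.2 fun T => ?_
  have hfin := hX.ae_finite (B := Metric.closedBall 0 M ×ˢ Iio (T : ℝ≥0))
    (Metric.isClosed_closedBall.measurableSet.prod measurableSet_Iio) (by
      rw [intensity_prod_Iio]
      exact ENNReal.mul_ne_top measure_closedBall_lt_top.ne ENNReal.coe_ne_top)
  filter_upwards [hfin] with ω hω
  exact hω.subset fun p hp => ⟨hp.1.1, hM hp.1.2.1, hp.2⟩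

/-- The number of accepted points of the process restricted to a set `D` with bounded spatial
projection is, up to a null set, a function of the point counts in subsets of `D`. -/
theorem IsPoissonProcess.exists_measurable_accepted (hS : IsSolid S)
    (hX : IsPoissonProcess X (intensity d) P) {B : Set (Space d)} (hB : Bornology.IsBounded B)
    {D : Set (SpaceTime d)} (hD : MeasurableSet D) (hDB : D ⊆ cylinder B) :
    ∃ g : Ω → ℝ, Measurable[countSigma X D] g ∧
      (fun ω => ((accepted S (X ω ∩ D)).ncard : ℝ)) =ᵐ[P] g := by
  let D' : ℕ → Set (SpaceTime d) := fun T => D ∩ {p | p.2 < (T : ℝ≥0)}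
  have hD' : ∀ T, MeasurableSet (D' T) := fun T =>
    hD.inter (measurableSet_lt measurable_snd measurable_const)
  -- The inner limsup refines the grid at a fixed time horizon `T`; the outer one lets `T` grow.
  -- Almost surely both sequences are eventually constant, the outer one because finitely many
  -- points are accepted in total.
  refine ⟨_, @measurable_toReal_limsup_limsup Ω (countSigma X D)
    (fun T n ω => cellCount S n (cellIndex n '' (X ω ∩ D' T))) fun T n =>
      (measurable_cellCount n hB (hD' T) fun p hp => ⟨(hDB hp.1).1, hp.2⟩).mono
        (countSigma_mono inter_subset_left) le_rfl, ?_⟩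
  obtain ⟨C, hC⟩ := hS.accepted_encard_le hB
  filter_upwards [hX.ae_timeFinite hB] with ω hω
  have hTF : TimeFinite (X ω ∩ D) := hω.mono (inter_subset_inter_right _ hDB)
  have hFI := hTF.finiteInitial
  have h1 : ∀ T : ℕ, limsup (fun n => (cellCount S n (cellIndex n '' (X ω ∩ D' T)) : ℝ≥0∞)) atTop =
      ((accepted S (X ω ∩ D' T)).ncard : ℝ≥0∞) := fun T => by
    refine limsup_of_eventually_eq ?_
    have hfin : (X ω ∩ D' T).Finite := by
      simpa only [D', inter_assoc] using hTF T
    filter_upwards [eventually_cellCount hS hfin] with n hn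
    rw [hn]
  have hAfin : (accepted S (X ω ∩ D)).Finite :=
    Set.encard_lt_top_iff.1 ((hC _ (inter_subset_right.trans hDB) hFI).trans_lt
      (ENat.natCast_lt_top C))
  have h2 : ∀ᶠ T : ℕ in atTop, ((accepted S (X ω ∩ D' T)).ncard : ℝ≥0∞) =
      ((accepted S (X ω ∩ D)).ncard : ℝ≥0∞) := by
    have : ∀ᶠ T : ℕ in atTop, ∀ p ∈ accepted S (X ω ∩ D), p.2 < (T : ℝ≥0) := by
      rw [hAfin.eventually_all]
      intro p _
      obtain ⟨T, hT⟩ := exists_nat_gt p.2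
      filter_upwards [eventually_ge_atTop T] with T' hT'
      exact hT.trans_le (by exact_mod_cast hT')
    filter_upwards [this] with T hT
    have e : X ω ∩ D' T = X ω ∩ D ∩ {p | p.2 < (T : ℝ≥0)} := by simp only [D', inter_assoc]
    rw [e, accepted_inter_time hFI,
      inter_eq_left.2 (show accepted S (X ω ∩ D) ⊆ {p | p.2 < (T : ℝ≥0)} from hT)]
  simp_rw [h1]
  rw [limsup_of_eventually_eq h2]
  simp

end Discretization

/-! ### The norm of the solid, separated sets, periodic sets and cubes. -/

section Geometry

variable {d : ℕ}

/-- Adjacency is expressed by a norm which is equivalent to the supremum norm. -/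
theorem IsSolid.exists_seminorm {S : Set (Space d)} (hS : IsSolid S) :
    ∃ (p : Seminorm ℝ (Space d)) (c C : ℝ), 0 < c ∧ 0 < C ∧ (∀ x, c * ‖x‖ ≤ p x) ∧
      (∀ x, p x ≤ C * ‖x‖) ∧ ∀ x y : SpaceTime d, Adjacent S x y ↔ p (x.1 - y.1) ≤ 1 := by
  obtain ⟨r, hr, hball⟩ := hS.exists_ball_subset
  have hnhds : S - S ∈ nhds 0 := Filter.mem_of_superset (Metric.ball_mem_nhds 0 hr) hball
  have hconv : Convex ℝ (S - S) := hS.convex.sub hS.convex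
  -- The norm is the gauge of the symmetric convex body `S - S`; compactness makes this body its
  -- closed unit ball.
  have hbal : Balanced ℝ (S - S) := by
    rw [balanced_iff_neg_mem hconv]
    rintro x hx
    obtain ⟨a, ha, b, hb, rfl⟩ := Set.mem_sub.1 hx
    exact Set.mem_sub.2 ⟨b, hb, a, ha, by abel⟩
  have habs : Absorbent ℝ (S - S) := absorbent_nhds_zero hnhds
  obtain ⟨R, hR0, hR⟩ : ∃ R > 0, S - S ⊆ Metric.closedBall 0 R := by
    obtain ⟨R, hR⟩ := hS.isCompact_sub.isBounded.subset_closedBall 0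
    exact ⟨max R 1, by positivity, hR.trans (Metric.closedBall_subset_closedBall (le_max_left _ _))⟩
  refine ⟨gaugeSeminorm hbal hconv habs, R⁻¹, r⁻¹, by positivity, by positivity, fun x => ?_,
    fun x => ?_, fun x y => ?_⟩
  · have := le_gauge_of_subset_closedBall habs hR0.le hR (x := x)
    rwa [div_eq_inv_mul] at this
  · have := mul_gauge_le_norm (x := x) hball
    rw [inv_mul_eq_div, le_div_iff₀ hr, mul_comm]
    exact this
  · rw [adjacent_iff]
    change _ ↔ gauge (S - S) _ ≤ 1
    rw [gauge_le_one_iff_mem_closure hconv hnhds, hS.isCompact_sub.isClosed.closure_eq]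

/-- Balls of radius `r / 2` about the points are disjoint, and each has volume `r ^ d` in the
supremum norm. -/
theorem card_mul_le_volume {r : ℝ} (hr : 0 < r) (t : Finset (Space d)) {U : Set (Space d)}
    (hsep : ∀ x ∈ t, ∀ y ∈ t, x ≠ y → r ≤ ‖x - y‖)
    (hU : ∀ x ∈ t, Metric.ball x (r / 2) ⊆ U) :
    (t.card : ℝ≥0∞) * ENNReal.ofReal r ^ d ≤ volume U := by
  have h1 : volume (⋃ x ∈ t, Metric.ball x (r / 2)) = t.card * ENNReal.ofReal r ^ d := by
    rw [measure_biUnion_finset]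
    · have h2 : ∀ x ∈ t, volume (Metric.ball x (r / 2)) = ENNReal.ofReal r ^ d := fun x _ => by
        rw [Real.volume_pi_ball _ (half_pos hr), mul_div_cancel₀ _ two_ne_zero, Fintype.card_fin,
          ENNReal.ofReal_pow hr.le]
      rw [Finset.sum_congr rfl h2, Finset.sum_const, nsmul_eq_mul]
    · intro x hx y hy hxy
      refine Metric.ball_disjoint_ball ?_
      rw [dist_eq_norm, add_halves]
      exact hsep x hx y hy hxy
    · exact fun x _ => Metric.isOpen_ball.measurableSet
  rw [← h1]
  exact measure_mono (iUnion₂_subset hU)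

/-- A separated set meets a bounded set in finitely many points. -/
theorem finite_of_separated {r : ℝ} (hr : 0 < r) {A B : Set (Space d)}
    (hsep : ∀ x ∈ A, ∀ y ∈ A, x ≠ y → r ≤ ‖x - y‖) (hB : Bornology.IsBounded B) :
    (A ∩ B).Finite := by
  by_contra hinf
  obtain ⟨M, hM⟩ := hB.subset_closedBall 0
  have hvol : volume (Metric.closedBall (0 : Space d) (M + r / 2)) ≠ ∞ :=
    measure_closedBall_lt_top.ne
  have hr' : ENNReal.ofReal r ^ d ≠ 0 := pow_ne_zero _ (by simpa using hr)
  have hr'' : ENNReal.ofReal r ^ d ≠ ∞ := ENNReal.pow_ne_top ENNReal.ofReal_ne_top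
  obtain ⟨n, hn⟩ := ENNReal.exists_nat_gt (ENNReal.div_ne_top hvol hr')
  obtain ⟨t, ht, htn⟩ := Set.Infinite.exists_subset_card_eq hinf n
  have h := card_mul_le_volume hr t (U := Metric.closedBall 0 (M + r / 2))
    (fun x hx y hy => hsep x (ht hx).1 y (ht hy).1) (fun x hx y hy => by
      have h1 := hM (ht hx).2
      rw [Metric.mem_closedBall] at h1 ⊢
      rw [Metric.mem_ball] at hy
      linarith [dist_triangle y x 0])
  rw [htn] at h
  rw [ENNReal.div_lt_iff (Or.inl hr') (Or.inl hr'')] at hn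
  exact absurd h (not_le.2 hn)

/-- The lattice vector `L k`. -/
def latticeVec (L : ℝ) (k : Fin d → ℤ) : Space d := fun i => L * k i

/-- For every norm there is a periodic set whose covering radius is smaller than its minimal
distance. -/
theorem exists_periodic (p : Seminorm ℝ (Space d)) {c C L : ℝ} (hc : 0 < c)
    (hpc : ∀ x, c * ‖x‖ ≤ p x) (hpC : ∀ x, p x ≤ C * ‖x‖) (hL : 1 ≤ c * L) :
    ∃ (A : Set (Space d)) (ρ : ℝ), ρ < 1 ∧ (∀ x ∈ A, ∀ k, x + latticeVec L k ∈ A) ∧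
      (∀ x ∈ A, ∀ y ∈ A, x ≠ y → 1 ≤ p (x - y)) ∧ ∀ z, ∃ x ∈ A, p (z - x) ≤ ρ := by
  have hL0 : 0 < L := by
    by_contra h
    nlinarith
  have hpcont : Continuous p := by
    refine p.continuous_of_continuousAt_zero ?_
    rw [ContinuousAt, map_zero]
    refine squeeze_zero (fun x => apply_nonneg p x) hpC ?_
    have : Continuous fun x : Space d => C * ‖x‖ := by fun_prop
    simpa using this.tendsto 0
  have hadd : ∀ k l : Fin d → ℤ, latticeVec L k + latticeVec L l = latticeVec L (k + l) := by
    intro k l; ext i; simp [latticeVec, mul_add]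
  have hsub : ∀ k l : Fin d → ℤ, latticeVec L k - latticeVec L l = latticeVec L (k - l) := by
    intro k l; ext i; simp [latticeVec, mul_sub]
  have hlat : ∀ k : Fin d → ℤ, k ≠ 0 → 1 ≤ p (latticeVec L k) := by
    intro k hk
    obtain ⟨i, hi⟩ := Function.ne_iff.1 hk
    refine le_trans ?_ (hpc _)
    have h1 : (1 : ℝ) ≤ |(k i : ℝ)| := by exact_mod_cast Int.one_le_abs hi
    have h2 : L ≤ ‖latticeVec L k‖ := by
      refine le_trans ?_ (norm_le_pi_norm _ i)
      rw [latticeVec, Real.norm_eq_abs, abs_mul, abs_of_pos hL0]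
      nlinarith
    nlinarith
  -- `A` is maximal among the `L`-periodic 1-separated sets.
  obtain ⟨A, hAmax⟩ := zorn_subset {A : Set (Space d) | (∀ x ∈ A, ∀ k, x + latticeVec L k ∈ A) ∧
      (∀ x ∈ A, ∀ y ∈ A, x ≠ y → 1 ≤ p (x - y))} (by
    intro c hcS hchain
    refine ⟨⋃₀ c, ⟨?_, ?_⟩, fun s hs => subset_sUnion_of_mem hs⟩
    · rintro x ⟨s, hs, hx⟩ k
      exact ⟨s, hs, (hcS hs).1 x hx k⟩
    · rintro x ⟨s, hs, hx⟩ y ⟨t, ht, hy⟩ hxy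
      rcases hchain.total hs ht with h | h
      · exact (hcS ht).2 x (h hx) y hy hxy
      · exact (hcS hs).2 x hx y (h hy) hxy)
  obtain ⟨hper, hsep⟩ := hAmax.prop
  -- An uncovered `z` could be added together with its lattice orbit, which is itself 1-separated
  -- because `1 ≤ c * L`.
  have hcov : ∀ z, ∃ x ∈ A, p (z - x) < 1 := by
    intro z
    by_contra! hz
    have hzA : z ∈ A := by
      have hB : (∀ x ∈ A ∪ range (fun k => z + latticeVec L k), ∀ k,
            x + latticeVec L k ∈ A ∪ range (fun k => z + latticeVec L k)) ∧
          (∀ x ∈ A ∪ range (fun k => z + latticeVec L k),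
            ∀ y ∈ A ∪ range (fun k => z + latticeVec L k), x ≠ y → 1 ≤ p (x - y)) := by
        have h1 : ∀ x ∈ A, ∀ k, 1 ≤ p (z + latticeVec L k - x) := by
          intro x hx k
          have := hz _ (hper x hx (-k))
          have e : z + latticeVec L k - x = z - (x + latticeVec L (-k)) := by
            ext i; simp [latticeVec]; ring
          rwa [e]
        constructor
        · rintro x (hx | ⟨l, rfl⟩) k
          · exact Or.inl (hper x hx k)
          · exact Or.inr ⟨l + k, by simp only [← hadd, add_assoc]⟩
        · rintro x (hx | ⟨k, rfl⟩) y (hy | ⟨l, rfl⟩) hxy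
          · exact hsep x hx y hy hxy
          · rw [map_sub_rev]; exact h1 x hx l
          · exact h1 y hy k
          · rw [add_sub_add_left_eq_sub, hsub]
            refine hlat _ fun h => hxy ?_
            rw [sub_eq_zero.1 h]
      exact hAmax.le_of_ge hB subset_union_left (Or.inr ⟨0, by ext i; simp [latticeVec]⟩)
    have := hz z hzA
    simp at this
    linarith
  -- Compactness of one period cell turns the pointwise bound below 1 into a uniform one;
  -- periodicity carries it everywhere.
  let O : ℕ → Set (Space d) := fun n => {z | ∃ x ∈ A, p (z - x) < 1 - 1 / ((n : ℝ) + 1)}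
  have hO : ∀ n, IsOpen (O n) := by
    intro n
    have : O n = ⋃ x ∈ A, {z | p (z - x) < 1 - 1 / ((n : ℝ) + 1)} := by ext; simp [O]
    rw [this]
    exact isOpen_biUnion fun x _ => isOpen_lt (by fun_prop) continuous_const
  have hOmono : Monotone O := by
    rintro m n hmn z ⟨x, hx, h⟩
    refine ⟨x, hx, h.trans_le ?_⟩
    have : (m : ℝ) ≤ n := by exact_mod_cast hmn
    gcongr
  obtain ⟨n, hn⟩ := (isCompact_Icc (a := (0 : Space d)) (b := fun _ => L)).elim_directed_cover O hO
    (by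
      intro z _
      obtain ⟨x, hx, h⟩ := hcov z
      obtain ⟨n, hn⟩ := exists_nat_one_div_lt (sub_pos.2 h)
      exact mem_iUnion.2 ⟨n, x, hx, by linarith⟩)
    hOmono.directed_le
  refine ⟨A, 1 - 1 / ((n : ℝ) + 1), by linarith [Nat.one_div_pos_of_nat (α := ℝ) (n := n)], hper,
    hsep, fun z => ?_⟩
  have hmem : (z - latticeVec L fun i => ⌊z i / L⌋) ∈ Icc (0 : Space d) fun _ => L := by
    constructor <;> intro i
    · have := Int.floor_le (z i / L)
      rw [le_div_iff₀ hL0] at this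
      simp only [latticeVec, Pi.sub_apply, Pi.zero_apply]
      linarith
    · have := Int.lt_floor_add_one (z i / L)
      rw [div_lt_iff₀ hL0] at this
      simp only [latticeVec, Pi.sub_apply]
      linarith
  obtain ⟨x, hx, h⟩ := hn hmem
  refine ⟨_, hper x hx fun i => ⌊z i / L⌋, ?_⟩
  rw [add_comm, ← sub_sub]
  exact h.le

/-- The cube `[-r, M + r)ᵈ`. -/
def cube (d : ℕ) (M r : ℝ) : Set (Space d) := univ.pi fun _ => Ico (-r) (M + r)

theorem mem_cube {M r : ℝ} {x : Space d} : x ∈ cube d M r ↔ ∀ i, -r ≤ x i ∧ x i < M + r := by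
  simp [cube]

theorem measurableSet_cube (M r : ℝ) : MeasurableSet (cube d M r) :=
  MeasurableSet.univ_pi fun _ => measurableSet_Ico

theorem isBounded_cube (M r : ℝ) : Bornology.IsBounded (cube d M r) :=
  Bornology.IsBounded.pi fun _ => Metric.isBounded_Ico _ _

theorem volume_cube (M r : ℝ) : volume (cube d M r) = ENNReal.ofReal (M + 2 * r) ^ d := by
  rw [cube, Real.volume_pi_Ico]
  simp [show M + r + r = M + 2 * r by ring]

theorem cube_mono {M r r' : ℝ} (h : r ≤ r') : cube d M r ⊆ cube d M r' := fun x hx => by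
  rw [mem_cube] at hx ⊢
  exact fun i => ⟨by linarith [(hx i).1], by linarith [(hx i).2]⟩

theorem mem_cube_of_norm_le {M r r' t : ℝ} {x y : Space d} (hx : x ∈ cube d M r)
    (h : ‖x - y‖ ≤ t) (hr : r + t ≤ r') : y ∈ cube d M r' := by
  rw [mem_cube] at hx ⊢
  intro i
  have h1 := (norm_le_pi_norm (x - y) i).trans h
  rw [Pi.sub_apply, Real.norm_eq_abs, abs_le] at h1
  exact ⟨by linarith [(hx i).1], by linarith [(hx i).2]⟩

theorem ncard_periodic_inter_cube {A : Set (Space d)} {L : ℝ} (hL : 0 < L)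
    (hper : ∀ x ∈ A, ∀ k, x + latticeVec L k ∈ A) (N : ℕ) :
    (A ∩ cube d (N * L) 0).ncard = N ^ d * (A ∩ cube d L 0).ncard := by
  let f : (Fin d → Fin N) × Space d → Space d := fun q => q.2 + latticeVec L fun i => ((q.1 i : ℕ) : ℤ)
  have himg : A ∩ cube d (N * L) 0 = f '' (univ ×ˢ (A ∩ cube d L 0)) := by
    ext x
    constructor
    · rintro ⟨hxA, hx⟩
      rw [mem_cube] at hx
      have hN : ∀ i, ⌊x i / L⌋₊ < N := fun i => by
        rw [Nat.floor_lt (by have := (hx i).1; rw [neg_zero] at this; positivity), div_lt_iff₀ hL]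
        linarith [(hx i).2]
      refine ⟨(fun i => ⟨⌊x i / L⌋₊, hN i⟩, x + latticeVec L fun i => -((⌊x i / L⌋₊ : ℕ) : ℤ)),
        ⟨mem_univ _, hper x hxA _, ?_⟩, ?_⟩
      · rw [mem_cube]
        intro i
        have h0 : 0 ≤ x i / L := by have := (hx i).1; rw [neg_zero] at this; positivity
        have h1 := Nat.floor_le h0
        have h2 := Nat.lt_floor_add_one (x i / L)
        rw [le_div_iff₀ hL] at h1
        rw [div_lt_iff₀ hL] at h2
        simp only [latticeVec, Pi.add_apply]
        push_cast
        constructor <;> linarith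
      · ext i
        simp [f, latticeVec]
    · rintro ⟨⟨k, y⟩, ⟨-, hyA, hy⟩, rfl⟩
      refine ⟨hper y hyA _, ?_⟩
      rw [mem_cube] at hy ⊢
      intro i
      have h1 : ((k i : ℕ) : ℝ) + 1 ≤ N := by exact_mod_cast (k i).2
      have h2 : (0 : ℝ) ≤ ((k i : ℕ) : ℝ) := by positivity
      have := hy i
      simp only [f, latticeVec, Pi.add_apply]
      push_cast
      constructor <;> nlinarith
  have hinj : InjOn f (univ ×ˢ (A ∩ cube d L 0)) := by
    rintro ⟨k, x⟩ ⟨-, -, hx⟩ ⟨l, y⟩ ⟨-, -, hy⟩ h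
    rw [mem_cube] at hx hy
    have hkl : k = l := by
      ext i
      have h1 := congrFun h i
      simp only [f, latticeVec, Pi.add_apply] at h1
      push_cast at h1
      have hxi := hx i
      have hyi := hy i
      by_contra hne
      rcases lt_or_gt_of_ne hne with hlt | hlt
      · have : ((k i : ℕ) : ℝ) + 1 ≤ (l i : ℕ) := by exact_mod_cast hlt
        nlinarith
      · have : ((l i : ℕ) : ℝ) + 1 ≤ (k i : ℕ) := by exact_mod_cast hlt
        nlinarith
    subst hkl
    refine Prod.ext rfl ?_
    simpa [f] using h
  rw [himg, hinj.ncard_image, Set.ncard_prod]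
  simp [Set.ncard_univ, Nat.card_eq_fintype_card]

theorem smul_inter_cube {A : Set (Space d)} {s : ℝ} (hs : 0 < s) (M : ℝ) :
    (s • A) ∩ cube d (s * M) 0 = s • (A ∩ cube d M 0) := by
  ext x
  simp only [mem_inter_iff, Set.mem_smul_set_iff_inv_smul_mem₀ hs.ne', mem_cube]
  refine and_congr_right fun _ => forall_congr' fun i => ?_
  simp only [Pi.smul_apply, smul_eq_mul, neg_zero, add_zero, inv_mul_eq_div]
  rw [div_lt_iff₀ hs, mul_comm M, le_div_iff₀ hs, zero_mul]

theorem ncard_smul_periodic_inter_cube {A : Set (Space d)} {L s : ℝ} (hL : 0 < L) (hs : 0 < s)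
    (hper : ∀ x ∈ A, ∀ k, x + latticeVec L k ∈ A) (N : ℕ) :
    (s • A ∩ cube d (s * (N * L)) 0).ncard = N ^ d * (A ∩ cube d L 0).ncard := by
  rw [smul_inter_cube hs, ← ncard_periodic_inter_cube hL hper, ← Set.image_smul]
  exact (smul_right_injective _ hs.ne').injOn.ncard_image

end Geometry

/-! ### Existence of a switch. -/

section Switch

variable {d : ℕ}

/-- Locations of a shell `H` and of two fillings `G`, `G'` of the region `W ⊆ Q` enclosed by the
shell. All properties are stable under perturbations of the locations by less than `δ`. More solids
are packed in `W` when the first arrivals are close to `G` than when they are close to `G'`,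
whatever the later arrivals are. -/
structure IsSwitch (p : Seminorm ℝ (Space d)) (Q W : Set (Space d)) (δ : ℝ)
    (H G G' : Finset (Space d)) : Prop where
  pos : 0 < δ
  measurableSet : MeasurableSet W
  subset : W ⊆ Q
  ball_shell : ∀ h ∈ H, Metric.ball h δ ⊆ Q \ W
  ball_dense : ∀ g ∈ G, Metric.ball g δ ⊆ W
  ball_sparse : ∀ g ∈ G', Metric.ball g δ ⊆ W
  sep_dense : ∀ x ∈ H ∪ G, ∀ y ∈ H ∪ G, x ≠ y →
    ∀ x' ∈ Metric.ball x δ, ∀ y' ∈ Metric.ball y δ, 1 < p (x' - y')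
  sep_sparse : ∀ x ∈ H ∪ G', ∀ y ∈ H ∪ G', x ≠ y →
    ∀ x' ∈ Metric.ball x δ, ∀ y' ∈ Metric.ball y δ, 1 < p (x' - y')
  nbhd : ∀ x, (x ∈ W ∨ ∃ h ∈ H, x ∈ Metric.ball h δ) → ∀ y, p (x - y) ≤ 1 → y ∈ Q
  shield : ∀ x ∈ W, ∀ y ∉ W, p (x - y) ≤ 1 → ∃ h ∈ H, ∀ h' ∈ Metric.ball h δ, p (y - h') ≤ 1
  card_lt : ∀ T : Finset (Space d), (∀ t ∈ T, t ∈ W) →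
    (∀ t ∈ T, ∀ t' ∈ T, t ≠ t' → 1 < p (t - t')) →
    (∀ t ∈ T, ∀ g ∈ G', ∃ g' ∈ Metric.ball g δ, 1 < p (t - g')) → G'.card + T.card < G.card

theorem eventually_boundary_lt (m a b : ℝ) {r : ℝ} (hm : 0 < m) (hr : 0 < r) :
    ∀ᶠ j : ℕ in atTop, b ≤ m * j ∧ (m * j + a) ^ d - (m * j - b) ^ d < r ^ d * j ^ d := by
  have ha : Tendsto (fun j : ℕ => (m + a / j) ^ d - (m - b / j) ^ d) atTop (nhds 0) := by
    have h1 := ((tendsto_const_div_atTop_nhds_zero_nat a).const_add m).pow d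
    have h2 := ((tendsto_const_div_atTop_nhds_zero_nat b).const_sub m).pow d
    simpa using h1.sub h2
  have hb : Tendsto (fun j : ℕ => m * (j : ℝ)) atTop atTop :=
    tendsto_natCast_atTop_atTop.const_mul_atTop hm
  filter_upwards [ha.eventually_lt_const (pow_pos hr d), hb.eventually_ge_atTop b,
    eventually_gt_atTop 0] with j hj hbj hj0
  refine ⟨hbj, ?_⟩
  have hj' : (0 : ℝ) < j := by exact_mod_cast hj0
  have e1 : m * j + a = (m + a / j) * j := by field_simp
  have e2 : m * j - b = (m - b / j) * j := by field_simp
  rw [e1, e2, mul_pow, mul_pow, ← sub_mul]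
  exact mul_lt_mul_of_pos_right hj (by positivity)

/-- A separated set in the boundary layer of a cube has few points. -/
theorem card_boundary_layer {M u v r : ℝ} (hr : 0 < r) (hu : 0 ≤ u) (hv : 0 ≤ v)
    (hM : 2 * (v + r) ≤ M)
    (T : Finset (Space d)) (hT : ∀ t ∈ T, t ∈ cube d M u \ cube d M (-v))
    (hsep : ∀ x ∈ T, ∀ y ∈ T, x ≠ y → r ≤ ‖x - y‖) :
    T.card * r ^ d ≤ (M + 2 * (u + r)) ^ d - (M - 2 * (v + r)) ^ d := by
  have hsub : cube d M (-(v + r)) ⊆ cube d M (u + r) := cube_mono (by linarith)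
  have h := card_mul_le_volume hr T (U := cube d M (u + r) \ cube d M (-(v + r))) hsep (by
    intro t ht y hy
    rw [Metric.mem_ball, dist_comm, dist_eq_norm] at hy
    refine ⟨mem_cube_of_norm_le (hT t ht).1 hy.le (by linarith), fun h => (hT t ht).2 ?_⟩
    rw [norm_sub_rev] at hy
    exact mem_cube_of_norm_le h hy.le (by linarith))
  rw [measure_sdiff hsub (measurableSet_cube _ _).nullMeasurableSet (by
      rw [volume_cube]; exact ENNReal.pow_ne_top ENNReal.ofReal_ne_top), volume_cube, volume_cube,
    ← ENNReal.ofReal_pow (by linarith : 0 ≤ M + 2 * (u + r)),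
    ← ENNReal.ofReal_pow (by linarith : 0 ≤ M + 2 * -(v + r)), ← ENNReal.ofReal_pow hr.le,
    ← ENNReal.ofReal_sub _ (by apply pow_nonneg; linarith),
    ← ENNReal.ofReal_natCast, ← ENNReal.ofReal_mul (by positivity)] at h
  have h0 : 0 ≤ (M + 2 * (u + r)) ^ d - (M + 2 * -(v + r)) ^ d :=
    sub_nonneg.2 (pow_le_pow_left₀ (by linarith) (by linarith) d)
  rw [ENNReal.ofReal_le_ofReal_iff h0] at h
  refine h.trans (le_of_eq ?_)
  ring

/-- A seminorm which is bounded by a multiple of the norm changes little under perturbations. -/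
theorem Seminorm.sub_le_of_mem_ball {p : Seminorm ℝ (Space d)} {C δ : ℝ} (hC : 0 < C)
    (hpC : ∀ x, p x ≤ C * ‖x‖) {x y y' : Space d} (hy : y' ∈ Metric.ball y δ) :
    p (x - y') ≤ p (x - y) + C * δ := by
  have h1 : p (x - y') ≤ p (x - y) + p (y - y') := by
    simpa using map_add_le_add p (x - y) (y - y')
  have h2 := hpC (y - y')
  rw [Metric.mem_ball, dist_comm, dist_eq_norm] at hy
  nlinarith

set_option maxHeartbeats 1000000 in
-- The dense filling is taken from `s • A`, the sparse filling and the shell from `(s * s) • A`. The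
-- dense filling wins by at least `j ^ d` points, while later additions to the sparse one are
-- confined to a boundary layer too small to hold `j ^ d` solids.
theorem exists_isSwitch (hd : 0 < d) (p : Seminorm ℝ (Space d)) {c C : ℝ} (hc : 0 < c)
    (hC : 0 < C) (hpc : ∀ x, c * ‖x‖ ≤ p x) (hpC : ∀ x, p x ≤ C * ‖x‖) :
    ∃ (M r δ : ℝ) (W : Set (Space d)) (H G G' : Finset (Space d)), 0 < M + 2 * r ∧
      IsSwitch p (cube d M r) W δ H G G' := by
  -- Vectors with `p x ≤ 1` have supremum norm at most `e`, so `e` bounds the range of interaction.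
  -- It also serves as the period of `A`.
  set e : ℝ := 1 / c with he
  have he0 : 0 < e := by positivity
  have hce : c * e = 1 := by rw [he]; field_simp
  have hnorm : ∀ {x : Space d} {a : ℝ}, p x ≤ a → a ≤ 1 → ‖x‖ ≤ e := by
    intro x a h ha
    rw [he, le_div_iff₀ hc, mul_comm]
    exact (hpc x).trans (h.trans ha)
  obtain ⟨A, ρ, hρ, hper, hsep, hcov⟩ := exists_periodic p hc hpc hpC hce.ge
  -- With `s = (q + 1) / q`, the identity `s * s * (q * e) = s * ((q + 1) * e)` provides a common
  -- period of the two dilates.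
  obtain ⟨q, hq0, hq⟩ : ∃ q : ℕ, 0 < q ∧ (1 + 1 / (q : ℝ)) * (1 + 1 / (q : ℝ)) * ρ < 1 := by
    have h1 := (tendsto_const_div_atTop_nhds_zero_nat (1 : ℝ)).const_add 1
    have h2 := (h1.mul h1).mul_const ρ
    simp only [add_zero, one_mul] at h2
    obtain ⟨q, h, h'⟩ := ((h2.eventually_lt_const hρ).and (eventually_gt_atTop 0)).exists
    exact ⟨q, h', h⟩
  have hq' : (0 : ℝ) < q := by exact_mod_cast hq0
  set s : ℝ := 1 + 1 / (q : ℝ) with hs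
  have hs1 : 1 < s := by
    have : 0 < 1 / (q : ℝ) := by positivity
    linarith
  have hs0 : 0 < s := by linarith
  have hqs : q * s = q + 1 := by rw [hs]; field_simp
  -- The four bounds keep a displacement within range `e`, preserve the strict separation of the
  -- dilates, preserve the covering by `(s * s) • A`, and make any two points of one ball adjacent.
  set δ : ℝ := min e (min ((s - 1) / (4 * C)) (min ((1 - s * s * ρ) / C) (1 / (2 * C)))) with hδ
  have hδ0 : 0 < δ := by
    have h1 : 0 < s - 1 := by linarith
    have h2 : 0 < 1 - s * s * ρ := by linarith
    rw [hδ]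
    positivity
  have hδe : δ ≤ e := min_le_left _ _
  have hδ1 : C * δ + C * δ < s - 1 := by
    have h : δ ≤ (s - 1) / (4 * C) := (min_le_right _ _).trans (min_le_left _ _)
    rw [le_div_iff₀ (by positivity)] at h
    nlinarith
  have hδ2 : s * s * ρ + C * δ ≤ 1 := by
    have h : δ ≤ (1 - s * s * ρ) / C :=
      (min_le_right _ _).trans ((min_le_right _ _).trans (min_le_left _ _))
    rw [le_div_iff₀ (by positivity)] at h
    nlinarith
  have hδ3 : C * δ + C * δ ≤ 1 := by
    have h : δ ≤ 1 / (2 * C) :=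
      (min_le_right _ _).trans ((min_le_right _ _).trans (min_le_right _ _))
    rw [le_div_iff₀ (by positivity)] at h
    nlinarith
  have hsepA : ∀ t : ℝ, 0 < t → ∀ x ∈ t • A, ∀ y ∈ t • A, x ≠ y → t ≤ p (x - y) := by
    rintro t ht _ ⟨x, hx, rfl⟩ _ ⟨y, hy, rfl⟩ hxy
    simp only
    rw [← smul_sub, map_smul_eq_mul, Real.norm_eq_abs, abs_of_pos ht]
    have := hsep x hx y hy fun h => hxy (by rw [h])
    nlinarith
  have hcovA : ∀ z, ∃ x ∈ (s * s) • A, p (z - x) ≤ s * s * ρ := by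
    intro z
    have hss : 0 < s * s := by positivity
    obtain ⟨x, hx, h⟩ := hcov ((s * s)⁻¹ • z)
    refine ⟨(s * s) • x, ⟨x, hx, rfl⟩, ?_⟩
    have e1 : z - (s * s) • x = (s * s) • ((s * s)⁻¹ • z - x) := by
      rw [smul_sub, smul_inv_smul₀ hss.ne']
    rw [e1, map_smul_eq_mul, Real.norm_eq_abs, abs_of_pos hss]
    exact mul_le_mul_of_nonneg_left h hss.le
  have hfin : ∀ t : ℝ, 1 ≤ t → ∀ B : Set (Space d), Bornology.IsBounded B →
      (t • A ∩ B).Finite := by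
    intro t ht B hB
    refine finite_of_separated (r := 1 / C) (by positivity) (fun x hx y hy hxy => ?_) hB
    rw [div_le_iff₀ hC, mul_comm]
    exact (ht.trans (hsepA t (by linarith) x hx y hy hxy)).trans (hpC _)
  have hsep2 : ∀ t, s ≤ t → ∀ x ∈ t • A, ∀ y ∈ t • A, x ≠ y →
      ∀ x' ∈ Metric.ball x δ, ∀ y' ∈ Metric.ball y δ, 1 < p (x' - y') := by
    intro t ht x hx y hy hxy x' hx' y' hy'
    have h1 := hsepA t (by linarith) x hx y hy hxy
    have h2 : p (x - y) ≤ p (x - y') + C * δ :=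
      Seminorm.sub_le_of_mem_ball hC hpC (Metric.mem_ball_comm.1 hy')
    have h3 : p (y' - x) ≤ p (y' - x') + C * δ :=
      Seminorm.sub_le_of_mem_ball hC hpC (Metric.mem_ball_comm.1 hx')
    rw [map_sub_rev p y' x, map_sub_rev p y' x'] at h3
    linarith
  -- A nonempty period cell is what makes the difference in density strict.
  have hκ : 1 ≤ (A ∩ cube d e 0).ncard := by
    rw [Nat.one_le_iff_ne_zero, Ne,
      Set.ncard_eq_zero (by simpa using hfin 1 le_rfl _ (isBounded_cube e 0))]
    intro hempty
    obtain ⟨x, hx, -⟩ := hcov 0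
    have : x + latticeVec e (fun i => -⌊x i / e⌋) ∈ A ∩ cube d e 0 := by
      refine ⟨hper x hx _, mem_cube.2 fun i => ?_⟩
      have h1 := Int.floor_le (x i / e)
      have h2 := Int.lt_floor_add_one (x i / e)
      rw [le_div_iff₀ he0] at h1
      rw [div_lt_iff₀ he0] at h2
      simp only [latticeVec, Pi.add_apply]
      push_cast
      constructor <;> linarith
    rw [hempty] at this
    exact this
  have hm0 : 0 < s * s * (q * e) := by positivity
  -- The volume of the boundary layer has order `j ^ (d - 1)`, hence is eventually below `j ^ d`
  -- times the volume `(1 / C) ^ d` occupied by one solid.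
  obtain ⟨j, hj1, hj2⟩ := (eventually_boundary_lt (d := d) (s * s * (q * e))
    (2 * (5 * e + 1 / C)) (2 * (e + 1 / C)) hm0 (show 0 < 1 / C by positivity)).exists
  set M : ℝ := s * s * (q * e) * j with hM
  have hM0 : 0 < M := lt_of_lt_of_le (by positivity) hj1
  have hMs : M = s * s * (((j * q : ℕ) : ℝ) * e) := by rw [hM]; push_cast; ring
  have hMd : M = s * (((j * (q + 1) : ℕ) : ℝ) * e) := by
    rw [hM]; push_cast; rw [← hqs]; ring
  have hcG := ncard_smul_periodic_inter_cube he0 hs0 hper (j * (q + 1))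
  have hcG' := ncard_smul_periodic_inter_cube he0 (show 0 < s * s by positivity) hper (j * q)
  rw [← hMd] at hcG
  rw [← hMs] at hcG'
  have hGf := hfin s hs1.le _ (isBounded_cube M 0)
  have hGf' := hfin (s * s) (by nlinarith) _ (isBounded_cube M 0)
  have hHf := hfin (s * s) (by nlinarith) _ ((isBounded_cube M (7 * e)).subset
    (sdiff_subset : cube d M (7 * e) \ cube d M (4 * e) ⊆ _))
  have hcard : hGf'.toFinset.card + j ^ d ≤ hGf.toFinset.card := by
    rw [← Set.ncard_eq_toFinset_card _ hGf, ← Set.ncard_eq_toFinset_card _ hGf', hcG, hcG',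
      mul_pow, mul_pow]
    have h1 : q ^ d + 1 ≤ (q + 1) ^ d :=
      Nat.pow_lt_pow_left (Nat.lt_succ_self q) hd.ne'
    set κ := (A ∩ cube d e 0).ncard
    calc j ^ d * q ^ d * κ + j ^ d ≤ j ^ d * q ^ d * κ + j ^ d * κ := by
          gcongr; exact Nat.le_mul_of_pos_right _ hκ
      _ = j ^ d * (q ^ d + 1) * κ := by ring
      _ ≤ j ^ d * (q + 1) ^ d * κ := by gcongr
  have hHsub : ∀ h ∈ hHf.toFinset, Metric.ball h δ ⊆ cube d M (8 * e) := by
    intro h hh y hy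
    rw [Set.Finite.mem_toFinset] at hh
    rw [Metric.mem_ball, dist_comm, dist_eq_norm] at hy
    exact mem_cube_of_norm_le hh.2.1 hy.le (by linarith)
  have hGH : ∀ g ∈ cube d M 0, ∀ h ∈ hHf.toFinset, ∀ g' ∈ Metric.ball g δ,
      ∀ h' ∈ Metric.ball h δ, 1 < p (g' - h') := by
    intro g hg h hh g' hg' h' hh'
    by_contra hle
    rw [Set.Finite.mem_toFinset] at hh
    refine hh.2.2 ?_
    rw [Metric.mem_ball, dist_comm, dist_eq_norm] at hg'
    rw [Metric.mem_ball, dist_eq_norm] at hh'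
    have h1 := mem_cube_of_norm_le hg hg'.le le_rfl
    have h2 := mem_cube_of_norm_le h1 (hnorm (not_lt.1 hle) le_rfl) le_rfl
    exact mem_cube_of_norm_le h2 hh'.le (by linarith)
  have hballW : ∀ g ∈ cube d M 0, Metric.ball g δ ⊆
      cube d M (5 * e) \ ⋃ h ∈ hHf.toFinset, Metric.ball h δ := by
    intro g hg y hy
    refine ⟨?_, ?_⟩
    · rw [Metric.mem_ball, dist_comm, dist_eq_norm] at hy
      exact mem_cube_of_norm_le hg hy.le (by linarith)
    · simp only [mem_iUnion, not_exists]
      intro h hh hyh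
      have := hGH g hg h hh y hy y hyh
      rw [sub_self, map_zero] at this
      linarith
  have hsepGH : ∀ t, s ≤ t → ∀ G : Finset (Space d), (∀ g ∈ G, g ∈ t • A ∩ cube d M 0) →
      ∀ x ∈ hHf.toFinset ∪ G, ∀ y ∈ hHf.toFinset ∪ G, x ≠ y →
      ∀ x' ∈ Metric.ball x δ, ∀ y' ∈ Metric.ball y δ, 1 < p (x' - y') := by
    intro t ht G hG x hx y hy hxy x' hx' y' hy'
    rw [Finset.mem_union] at hx hy
    rcases hx with hx | hx <;> rcases hy with hy | hy
    · refine hsep2 (s * s) (by nlinarith) x ?_ y ?_ hxy x' hx' y' hy'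
      · exact ((Set.Finite.mem_toFinset _).1 hx).1
      · exact ((Set.Finite.mem_toFinset _).1 hy).1
    · rw [map_sub_rev]
      exact hGH y (hG y hy).2 x hx y' hy' x' hx'
    · exact hGH x (hG x hx).2 y hy x' hx' y' hy'
    · exact hsep2 t ht x (hG x hx).1 y (hG y hy).1 hxy x' hx' y' hy'
  -- The margins count interaction ranges. Fillings lie in the cube of margin 0, and shell sites
  -- between margins 4 and 7, out of reach of the fillings. Points outside margin 5 that can touch
  -- `W` lie within margin 6 and are covered from that shell. Shell balls stay within margin 8,
  -- their neighbours within 9.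
  refine ⟨M, 9 * e, δ, cube d M (5 * e) \ ⋃ h ∈ hHf.toFinset, Metric.ball h δ, hHf.toFinset,
    hGf.toFinset, hGf'.toFinset, by linarith, ?_⟩
  constructor
  · exact hδ0
  · exact (measurableSet_cube _ _).diff
      (Finset.measurableSet_biUnion _ fun h _ => Metric.isOpen_ball.measurableSet)
  · exact sdiff_subset.trans (cube_mono (by linarith))
  · intro h hh y hy
    refine ⟨cube_mono (by linarith) (hHsub h hh hy), fun hW => hW.2 ?_⟩
    exact mem_iUnion₂.2 ⟨h, hh, hy⟩
  · exact fun g hg => hballW g ((Set.Finite.mem_toFinset _).1 hg).2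
  · exact fun g hg => hballW g ((Set.Finite.mem_toFinset _).1 hg).2
  · exact hsepGH s le_rfl _ fun g hg => (Set.Finite.mem_toFinset _).1 hg
  · exact hsepGH (s * s) (by nlinarith) _ fun g hg => (Set.Finite.mem_toFinset _).1 hg
  · rintro x hx y hxy
    have hx8 : x ∈ cube d M (8 * e) := by
      rcases hx with hx | ⟨h, hh, hx⟩
      · exact cube_mono (by linarith) hx.1
      · exact hHsub h hh hx
    exact mem_cube_of_norm_le hx8 (hnorm hxy le_rfl) (by linarith)
  · intro x hx y hy hxy
    by_cases hyH : y ∈ ⋃ h ∈ hHf.toFinset, Metric.ball h δ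
    -- The shell balls were cut out of `W`, so `y` may lie in one; then the shell point of the same
    -- ball blocks it.
    · obtain ⟨h, hh, hyh⟩ := mem_iUnion₂.1 hyH
      refine ⟨h, hh, fun h' hh' => ?_⟩
      have h1 : p (y - h') ≤ p (y - h) + C * δ := Seminorm.sub_le_of_mem_ball hC hpC hh'
      have h2 : p (y - h) ≤ p (y - y) + C * δ :=
        Seminorm.sub_le_of_mem_ball hC hpC (Metric.mem_ball_comm.1 hyh)
      rw [sub_self, map_zero] at h2
      linarith
    · have hy5 : y ∉ cube d M (5 * e) := fun h => hy ⟨h, hyH⟩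
      have hy6 : y ∈ cube d M (6 * e) :=
        mem_cube_of_norm_le hx.1 (hnorm hxy le_rfl) (by linarith)
      obtain ⟨h, hh, hyh⟩ := hcovA y
      have hn := hnorm hyh hq.le
      refine ⟨h, ?_, fun h' hh' => ?_⟩
      · rw [Set.Finite.mem_toFinset]
        refine ⟨hh, mem_cube_of_norm_le hy6 hn (by linarith), fun h4 => hy5 ?_⟩
        rw [norm_sub_rev] at hn
        exact mem_cube_of_norm_le h4 hn (by linarith)
      · have h1 : p (y - h') ≤ p (y - h) + C * δ := Seminorm.sub_le_of_mem_ball hC hpC hh'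
        linarith
  · intro T hTW hTsep hTG
    have h := card_boundary_layer (d := d) (M := M) (u := 5 * e) (v := e) (r := 1 / C)
      (by positivity) (by positivity) he0.le hj1 T (by
        intro t ht
        refine ⟨(hTW t ht).1, fun hte => ?_⟩
        -- Deeper than `e` inside the cube, a covering site of `(s * s) • A` belongs to the sparse
        -- filling and blocks `t` even after displacement.
        obtain ⟨g, hg, htg⟩ := hcovA t
        obtain ⟨g', hg', hlt⟩ := hTG t ht g (by
          rw [Set.Finite.mem_toFinset]
          exact ⟨hg, mem_cube_of_norm_le hte (hnorm htg hq.le) (by linarith)⟩)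
        have h1 : p (t - g') ≤ p (t - g) + C * δ := Seminorm.sub_le_of_mem_ball hC hpC hg'
        linarith) (by
        intro x hx y hy hxy
        rw [div_le_iff₀ hC, mul_comm]
        exact (hTsep x hx y hy hxy).le.trans (hpC _))
    have h2 : (T.card : ℝ) * (1 / C) ^ d < j ^ d * (1 / C) ^ d := by
      rw [mul_comm ((j : ℝ) ^ d)]
      exact h.trans_lt hj2
    have h3 : (T.card : ℝ) < j ^ d := lt_of_mul_lt_mul_right h2 (by positivity)
    have h4 : T.card < j ^ d := by exact_mod_cast h3
    omega

end Switch

/-! ### Effect of a switch on the packing. -/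

section Isolation

variable {d : ℕ} {S : Set (Space d)} {p : Seminorm ℝ (Space d)} {Q W : Set (Space d)} {δ : ℝ}
  {H G G' F : Finset (Space d)} {Y : Set (SpaceTime d)} {z : Space d}

/-- Points of the translate of `B` by `z` which arrive before time `1`. -/
def early (z : Space d) (B : Set (Space d)) : Set (SpaceTime d) := ((· - z) ⁻¹' B) ×ˢ Iio 1

/-- The points of `Y` in the translate of `U` by `z` that arrive before time `1` are exactly one
point near each point of `F`. -/
def Pattern (Y : Set (SpaceTime d)) (z : Space d) (U : Set (Space d)) (F : Finset (Space d))
    (δ : ℝ) : Prop :=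
  (∀ f ∈ F, (Y ∩ early z (Metric.ball f δ)).encard = 1) ∧
    (Y ∩ early z (U \ ⋃ f ∈ F, Metric.ball f δ)).encard = 0

theorem Pattern.exists_mem {U : Set (Space d)} (h : Pattern Y z U F δ) {f : Space d}
    (hf : f ∈ F) : ∃ q ∈ Y, q ∈ early z (Metric.ball f δ) := by
  obtain ⟨q, hq⟩ := Set.encard_eq_one.1 (h.1 f hf)
  have : q ∈ Y ∩ early z (Metric.ball f δ) := by rw [hq]; rfl
  exact ⟨q, this.1, this.2⟩

theorem Pattern.eq {U : Set (Space d)} (h : Pattern Y z U F δ) {f : Space d} (hf : f ∈ F)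
    {q q' : SpaceTime d} (hq : q ∈ Y) (hq' : q' ∈ Y) (hqf : q ∈ early z (Metric.ball f δ))
    (hqf' : q' ∈ early z (Metric.ball f δ)) : q = q' := by
  obtain ⟨r, hr⟩ := Set.encard_eq_one.1 (h.1 f hf)
  have h1 : q ∈ Y ∩ early z (Metric.ball f δ) := ⟨hq, hqf⟩
  have h2 : q' ∈ Y ∩ early z (Metric.ball f δ) := ⟨hq', hqf'⟩
  rw [hr] at h1 h2
  exact h1.trans h2.symm

theorem Pattern.exists_ball {U : Set (Space d)} (h : Pattern Y z U F δ) {q : SpaceTime d}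
    (hq : q ∈ Y) (hqU : q ∈ early z U) : ∃ f ∈ F, q ∈ early z (Metric.ball f δ) := by
  by_contra! hn
  have h0 := Set.encard_eq_zero.1 h.2
  refine (Set.eq_empty_iff_forall_notMem.1 h0 q) ⟨hq, ⟨hqU.1, fun hmem => ?_⟩, hqU.2⟩
  obtain ⟨f, hf, hqf⟩ := mem_iUnion₂.1 hmem
  exact hn f hf ⟨hqf, hqU.2⟩

/-- The early points near a switch in one of its two states are pairwise non-adjacent. -/
theorem Pattern.not_adjacent (hadj : ∀ x y : SpaceTime d, Adjacent S x y ↔ p (x.1 - y.1) ≤ 1)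
    (hsep : ∀ x ∈ H ∪ F, ∀ y ∈ H ∪ F, x ≠ y →
      ∀ x' ∈ Metric.ball x δ, ∀ y' ∈ Metric.ball y δ, 1 < p (x' - y'))
    (hH : Pattern Y z (Q \ W) H δ) (hF : Pattern Y z W F δ) {q q' : SpaceTime d} (hq : q ∈ Y)
    (hq' : q' ∈ Y) (hqQ : q ∈ early z Q) (hqQ' : q' ∈ early z Q) (hne : q ≠ q') :
    ¬ Adjacent S q q' := by
  have hex : ∀ q ∈ Y, q ∈ early z Q → ∃ f ∈ H ∪ F, q ∈ early z (Metric.ball f δ) := by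
    intro q hq hqQ
    by_cases hqW : q.1 - z ∈ W
    · obtain ⟨f, hf, h⟩ := hF.exists_ball hq ⟨hqW, hqQ.2⟩
      exact ⟨f, Finset.mem_union_right _ hf, h⟩
    · obtain ⟨f, hf, h⟩ := hH.exists_ball hq ⟨⟨hqQ.1, hqW⟩, hqQ.2⟩
      exact ⟨f, Finset.mem_union_left _ hf, h⟩
  obtain ⟨f, hf, hqf⟩ := hex q hq hqQ
  obtain ⟨f', hf', hqf'⟩ := hex q' hq' hqQ'
  by_cases hff : f = f'
  · subst hff
    rcases Finset.mem_union.1 hf with h | h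
    · exact absurd (hH.eq h hq hq' hqf hqf') hne
    · exact absurd (hF.eq h hq hq' hqf hqf') hne
  · rw [hadj, not_le, ← sub_sub_sub_cancel_right q.1 q'.1 z]
    exact hsep f hf f' hf' hff _ hqf.1 _ hqf'.1

/-- A preceding point in conflict with `q` would be another early point of `Q`, but early points of
`Q` are pairwise non-adjacent. -/
theorem IsSwitch.mem_accepted_of_early (sw : IsSwitch p Q W δ H G G')
    (hadj : ∀ x y : SpaceTime d, Adjacent S x y ↔ p (x.1 - y.1) ≤ 1) (hY : FiniteInitial Y)
    (hearly : ∀ q ∈ Y, ∀ q' ∈ Y, q ∈ early z Q → q' ∈ early z Q → q ≠ q' → ¬ Adjacent S q q')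
    {q : SpaceTime d} (hq : q ∈ Y) (hq1 : q.2 < 1)
    (hqW : q.1 - z ∈ W ∨ ∃ h ∈ H, q.1 - z ∈ Metric.ball h δ) : q ∈ accepted S Y := by
  refine (isPacked_accepted hY q).2 ⟨hq, fun q' hq' hlt hqq' => ?_⟩
  have hqQ : q.1 - z ∈ Q := sw.nbhd _ hqW _ (by simp)
  have hqQ' : q'.1 - z ∈ Q := sw.nbhd _ hqW _ (by
    rw [sub_sub_sub_cancel_right]; exact (hadj _ _).1 hqq')
  refine hearly q hq q' (accepted_subset _ hq') ⟨hqQ, hq1⟩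
    ⟨hqQ', lt_of_le_of_lt hlt.time_le hq1⟩ ?_ hqq'
  rintro rfl
  exact irrefl (r := Precedes) _ hlt

/-- The shell isolates the region `W`: the points in `W` do not influence the acceptance of the
points outside. -/
theorem IsSwitch.accepted_outside (sw : IsSwitch p Q W δ H G G')
    (hadj : ∀ x y : SpaceTime d, Adjacent S x y ↔ p (x.1 - y.1) ≤ 1) (hY : FiniteInitial Y)
    (hearly : ∀ q ∈ Y, ∀ q' ∈ Y, q ∈ early z Q → q' ∈ early z Q → q ≠ q' → ¬ Adjacent S q q')
    (hH : Pattern Y z (Q \ W) H δ) :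
    accepted S (Y \ cylinder ((· - z) ⁻¹' W)) = accepted S Y \ cylinder ((· - z) ⁻¹' W) := by
  have hF := hY.mono (sdiff_subset : Y \ cylinder ((· - z) ⁻¹' W) ⊆ Y)
  refine IsPacked.unique hF (isPacked_accepted hF) fun q => ?_
  constructor
  · rintro ⟨hq, hqW⟩
    exact ⟨⟨accepted_subset Y hq, hqW⟩, fun q' hq' => ((isPacked_accepted hY q).1 hq).2 q' hq'.1⟩
  rintro ⟨⟨hq, hqW⟩, h⟩
  refine ⟨(isPacked_accepted hY q).2 ⟨hq, fun q' hq' hlt hqq' => ?_⟩, hqW⟩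
  by_cases hqW' : q' ∈ cylinder ((· - z) ⁻¹' W)
  swap
  · exact h q' ⟨hq', hqW'⟩ hlt hqq'
  have hw : q'.1 - z ∈ W := hqW'.1
  have hn : q.1 - z ∉ W := fun hn => hqW ⟨hn, mem_univ _⟩
  have hp : p ((q'.1 - z) - (q.1 - z)) ≤ 1 := by
    rw [sub_sub_sub_cancel_right]; exact (hadj _ _).1 hqq'.symm
  have hqQ := sw.nbhd _ (Or.inl hw) _ hp
  -- A conflict across the boundary of `W` can only reject a late point; such a point is already
  -- rejected by an accepted early shell point, which lies outside `W`.
  have hnot : ¬ q.2 < 1 := by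
    intro hq1
    refine hearly q hq q' (accepted_subset _ hq') ⟨hqQ, hq1⟩
      ⟨sw.subset hw, lt_of_le_of_lt hlt.time_le hq1⟩ ?_ hqq'
    rintro rfl
    exact hn hw
  obtain ⟨f, hf, hblock⟩ := sw.shield _ hw _ hn hp
  obtain ⟨r, hr, hrf⟩ := hH.exists_mem hf
  have hrA : r ∈ accepted S Y :=
    sw.mem_accepted_of_early hadj hY hearly hr hrf.2 (Or.inr ⟨f, hf, hrf.1⟩)
  have hrW : r ∉ cylinder ((· - z) ⁻¹' W) := fun hrW => (sw.ball_shell f hf hrf.1).2 hrW.1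
  have hqr : Adjacent S q r := by
    rw [hadj, ← sub_sub_sub_cancel_right q.1 r.1 z]
    exact hblock _ hrf.1
  exact h r ⟨hrA, hrW⟩ (Or.inl (lt_of_lt_of_le hrf.2 (not_lt.1 hnot))) hqr

theorem IsSwitch.ncard_dense (sw : IsSwitch p Q W δ H G G')
    (hadj : ∀ x y : SpaceTime d, Adjacent S x y ↔ p (x.1 - y.1) ≤ 1) (hY : FiniteInitial Y)
    (hfin : (accepted S Y).Finite) (hH : Pattern Y z (Q \ W) H δ) (hG : Pattern Y z W G δ) :
    (accepted S (Y \ cylinder ((· - z) ⁻¹' W))).ncard + G.card ≤ (accepted S Y).ncard := by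
  have hearly : ∀ q ∈ Y, ∀ q' ∈ Y, q ∈ early z Q → q' ∈ early z Q → q ≠ q' → ¬ Adjacent S q q' :=
    fun q hq q' hq' hqQ hqQ' hne => hH.not_adjacent hadj sw.sep_dense hG hq hq' hqQ hqQ' hne
  rw [sw.accepted_outside hadj hY hearly hH,
    ← Set.ncard_inter_add_ncard_sdiff_eq_ncard (accepted S Y) (cylinder ((· - z) ⁻¹' W)) hfin,
    add_comm (accepted S Y ∩ _).ncard]
  gcongr
  have hex : ∀ g ∈ G, ∃ q ∈ Y, q ∈ early z (Metric.ball g δ) := fun g hg => hG.exists_mem hg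
  choose! f hfY hf using hex
  rw [← Set.ncard_coe_finset G]
  refine Set.ncard_le_ncard_of_injOn f (fun g hg => ?_) (fun g hg g' hg' hgg => ?_)
    (hfin.subset inter_subset_left)
  · have hw := sw.ball_dense g hg (hf g hg).1
    exact ⟨sw.mem_accepted_of_early hadj hY hearly (hfY g hg) (hf g hg).2 (Or.inl hw),
      hw, mem_univ _⟩
  · by_contra hne
    have h1 := (hf g hg).1
    have h2 := (hf g' hg').1
    rw [← hgg] at h2
    have := sw.sep_dense g (Finset.mem_union_right _ hg) g' (Finset.mem_union_right _ hg') hne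
      _ h1 _ h2
    rw [sub_self, map_zero] at this
    linarith

/-- Early accepted points in `W` number at most one per site of `G'`. The late ones must avoid all
the accepted points near `G'`, so `card_lt` bounds their number. -/
theorem IsSwitch.ncard_sparse (sw : IsSwitch p Q W δ H G G')
    (hadj : ∀ x y : SpaceTime d, Adjacent S x y ↔ p (x.1 - y.1) ≤ 1) (hY : FiniteInitial Y)
    (hfin : (accepted S Y).Finite) (hH : Pattern Y z (Q \ W) H δ) (hG : Pattern Y z W G' δ) :
    (accepted S Y).ncard < (accepted S (Y \ cylinder ((· - z) ⁻¹' W))).ncard + G.card := by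
  classical
  have hearly : ∀ q ∈ Y, ∀ q' ∈ Y, q ∈ early z Q → q' ∈ early z Q → q ≠ q' → ¬ Adjacent S q q' :=
    fun q hq q' hq' hqQ hqQ' hne => hH.not_adjacent hadj sw.sep_sparse hG hq hq' hqQ hqQ' hne
  rw [sw.accepted_outside hadj hY hearly hH,
    ← Set.ncard_inter_add_ncard_sdiff_eq_ncard (accepted S Y) (cylinder ((· - z) ⁻¹' W)) hfin,
    add_comm (accepted S Y ∩ _).ncard]
  gcongr
  set A := accepted S Y ∩ cylinder ((· - z) ⁻¹' W) with hA
  have hAfin : A.Finite := hfin.subset inter_subset_left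
  have hLfin : (A \ {q | q.2 < 1}).Finite := hAfin.subset sdiff_subset
  rw [← Set.ncard_inter_add_ncard_sdiff_eq_ncard A {q | q.2 < 1} hAfin]
  have hAsep : ∀ q ∈ A, ∀ q' ∈ A, q ≠ q' → 1 < p ((q.1 - z) - (q'.1 - z)) := by
    intro q hq q' hq' hne
    rw [sub_sub_sub_cancel_right, ← not_le, ← hadj]
    exact accepted_pairwise hY hq.1 hq'.1 hne
  have h1 : (A ∩ {q | q.2 < 1}).ncard ≤ G'.card := by
    have hex : ∀ q ∈ A ∩ {q | q.2 < 1}, ∃ g ∈ G', q ∈ early z (Metric.ball g δ) := by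
      rintro q ⟨⟨hq, hqW⟩, hq1⟩
      exact hG.exists_ball (accepted_subset _ hq) ⟨hqW.1, hq1⟩
    choose! f hfG hf using hex
    rw [← Set.ncard_coe_finset G']
    refine Set.ncard_le_ncard_of_injOn f hfG (fun q hq q' hq' hqq => ?_)
    have h2 := hf q' hq'
    rw [← hqq] at h2
    exact hG.eq (hfG q hq) (accepted_subset _ hq.1.1) (accepted_subset _ hq'.1.1) (hf q hq) h2
  have hinj : InjOn (fun q : SpaceTime d => q.1 - z) (A \ {q | q.2 < 1}) := by
    intro q hq q' hq' hqq
    by_contra hne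
    have := hAsep q hq.1 q' hq'.1 hne
    simp only at hqq
    rw [hqq, sub_self, map_zero] at this
    linarith
  have h2 := sw.card_lt (hLfin.toFinset.image fun q => q.1 - z) (by
      intro t ht
      obtain ⟨q, hq, rfl⟩ := Finset.mem_image.1 ht
      exact ((hLfin.mem_toFinset).1 hq).1.2.1) (by
      intro t ht t' ht' hne
      obtain ⟨q, hq, rfl⟩ := Finset.mem_image.1 ht
      obtain ⟨q', hq', rfl⟩ := Finset.mem_image.1 ht'
      exact hAsep q ((hLfin.mem_toFinset).1 hq).1 q' ((hLfin.mem_toFinset).1 hq').1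
        fun h => hne (by rw [h])) (by
      intro t ht g hg
      obtain ⟨q, hq, rfl⟩ := Finset.mem_image.1 ht
      rw [hLfin.mem_toFinset] at hq
      obtain ⟨r, hr, hrg⟩ := hG.exists_mem hg
      have hrW := sw.ball_sparse g hg hrg.1
      refine ⟨r.1 - z, hrg.1, hAsep q hq.1 r
        ⟨sw.mem_accepted_of_early hadj hY hearly hr hrg.2 (Or.inl hrW), hrW, mem_univ _⟩ ?_⟩
      rintro rfl
      exact hq.2 hrg.2)
  rw [Finset.card_image_of_injOn (by simpa using hinj), ← Set.ncard_eq_toFinset_card _ hLfin] at h2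
  omega

end Isolation

/-! ### Measurability and probability of patterns. -/

section PatternProbability

variable {d : ℕ} {Ω : Type*} {X : Ω → Set (SpaceTime d)} {U : Set (Space d)}
  {F : Finset (Space d)} {δ : ℝ} {z : Space d}

theorem early_mono {B B' : Set (Space d)} (h : B ⊆ B') : early z B ⊆ early z B' :=
  fun _ hq => ⟨h hq.1, hq.2⟩

theorem measurableSet_early {B : Set (Space d)} (hB : MeasurableSet B) :
    MeasurableSet (early z B) :=
  ((measurable_id.sub_const z) hB).prod measurableSet_Iio

theorem intensity_early (z : Space d) {B : Set (Space d)} (hB : MeasurableSet B) :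
    intensity d (early z B) = volume B := by
  rw [early, intensity_prod_Iio,
    (measurePreserving_sub_right volume z).measure_preimage hB.nullMeasurableSet]
  simp

theorem measurableSet_biUnion_ball (F : Finset (Space d)) (δ : ℝ) :
    MeasurableSet (⋃ f ∈ F, Metric.ball f δ) :=
  Finset.measurableSet_biUnion _ fun _ _ => Metric.isOpen_ball.measurableSet

theorem pattern_inter (hF : ∀ f ∈ F, Metric.ball f δ ⊆ U) {D : Set (SpaceTime d)}
    (hD : early z U ⊆ D) (Y : Set (SpaceTime d)) :
    Pattern (Y ∩ D) z U F δ ↔ Pattern Y z U F δ := by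
  have h : ∀ B ⊆ U, Y ∩ D ∩ early z B = Y ∩ early z B := fun B hB => by
    rw [inter_assoc, inter_eq_right.2 ((early_mono hB).trans hD)]
  unfold Pattern
  rw [h _ sdiff_subset]
  refine and_congr_left fun _ => forall₂_congr fun f hf => ?_
  rw [h _ (hF f hf)]

theorem measurableSet_pattern (hU : MeasurableSet U) (hF : ∀ f ∈ F, Metric.ball f δ ⊆ U)
    {D : Set (SpaceTime d)} (hD : early z U ⊆ D) :
    MeasurableSet[countSigma X D] {ω | Pattern (X ω) z U F δ} := by
  let _ := countSigma X D
  have h1 : {ω | Pattern (X ω) z U F δ} =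
      (⋂ f ∈ F, {ω | (X ω ∩ early z (Metric.ball f δ)).encard = 1}) ∩
        {ω | (X ω ∩ early z (U \ ⋃ f ∈ F, Metric.ball f δ)).encard = 0} := by
    ext ω
    simp [Pattern]
  rw [h1]
  refine MeasurableSet.inter (Finset.measurableSet_biInter _ fun f hf => ?_) ?_
  · exact measurable_count_countSigma (measurableSet_early Metric.isOpen_ball.measurableSet)
      ((early_mono (hF f hf)).trans hD) (measurableSet_singleton 1)
  · exact measurable_count_countSigma
      (measurableSet_early (hU.diff (measurableSet_biUnion_ball F δ)))
      ((early_mono sdiff_subset).trans hD) (measurableSet_singleton 0)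

variable [MeasurableSpace Ω] {P : Measure Ω}

theorem IsPoissonProcess.measure_counts_eq {α ι : Type*} [MeasurableSpace α] [Fintype ι]
    {X : Ω → Set α} {ν : Measure α} (hX : IsPoissonProcess X ν P) (B : ι → Set α) (n : ι → ℕ)
    (hB : ∀ i, MeasurableSet (B i)) (hν : ∀ i, ν (B i) ≠ ∞)
    (hd : Pairwise fun i j => Disjoint (B i) (B j)) :
    P {ω | ∀ i, (X ω ∩ B i).encard = n i} = ∏ i, ENNReal.ofReal
      (Real.exp (-(ν (B i)).toNNReal) * (ν (B i)).toNNReal ^ n i / (n i).factorial) := by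
  have h := (hX.indep_count_fintype B hB hd).meas_iInter
    (s := fun i => {ω | (X ω ∩ B i).encard = n i})
    (fun i => ⟨{(n i : ℕ∞)}, measurableSet_singleton _, rfl⟩)
  rw [← Set.ofPred_forall] at h
  rw [h]
  exact Finset.prod_congr rfl fun i _ => hX.count_eq (hB i) (hν i) (n i)

/-- The probability of a pattern is positive and does not depend on its position. -/
theorem IsPoissonProcess.exists_pattern_prob [IsProbabilityMeasure P]
    (hX : IsPoissonProcess X (intensity d) P) (hδ : 0 < δ) (hU : MeasurableSet U)
    (hUb : Bornology.IsBounded U)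
    (hdisj : ∀ f ∈ F, ∀ g ∈ F, f ≠ g → Disjoint (Metric.ball f δ) (Metric.ball g δ)) :
    ∃ c : ℝ, 0 < c ∧ ∀ z, P.real {ω | Pattern (X ω) z U F δ} = c := by
  -- The index `none` stands for the remainder of `U`, required to be empty; the others are the
  -- balls, each required to hold one point. Independence makes the probability a product depending
  -- on volumes alone.
  let B : Option F → Set (Space d) := fun i =>
    i.elim (U \ ⋃ f ∈ F, Metric.ball f δ) fun f => Metric.ball f.1 δ
  let n : Option F → ℕ := fun i => i.elim 0 fun _ => 1
  have hB : ∀ i, MeasurableSet (B i) := by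
    rintro (_ | f)
    · exact hU.diff (measurableSet_biUnion_ball F δ)
    · exact Metric.isOpen_ball.measurableSet
  have hv : ∀ i, volume (B i) ≠ ∞ := by
    rintro (_ | f)
    · exact (hUb.subset sdiff_subset).measure_lt_top.ne
    · exact measure_ball_lt_top.ne
  have hBd : Pairwise fun i j => Disjoint (B i) (B j) := by
    have h0 : ∀ f : F, Disjoint (B none) (B (some f)) := fun f =>
      disjoint_sdiff_left.mono_right (subset_biUnion_of_mem (u := fun f => Metric.ball f δ) f.2)
    rintro (_ | f) (_ | g) hne
    · exact absurd rfl hne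
    · exact h0 g
    · exact (h0 f).symm
    · exact hdisj f f.2 g g.2 fun h => hne (by rw [Subtype.ext h])
  have hprob : ∀ z, P {ω | Pattern (X ω) z U F δ} = ∏ i, ENNReal.ofReal
      (Real.exp (-(volume (B i)).toNNReal) * (volume (B i)).toNNReal ^ n i / (n i).factorial) := by
    intro z
    have h := hX.measure_counts_eq (fun i => early z (B i)) n (fun i => measurableSet_early (hB i))
      (fun i => by rw [intensity_early z (hB i)]; exact hv i) fun i j hij =>
        Set.disjoint_left.2 fun q hq hq' => Set.disjoint_left.1 (hBd hij) hq.1 hq'.1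
    simp only [fun i => intensity_early z (hB i)] at h
    rw [← h]
    congr 1
    ext ω
    simp [Pattern, Option.forall, B, n, and_comm]
  refine ⟨(∏ i, ENNReal.ofReal (Real.exp (-(volume (B i)).toNNReal) *
    (volume (B i)).toNNReal ^ n i / (n i).factorial)).toReal, ?_, fun z => by
      rw [measureReal_def, hprob]⟩
  rw [ENNReal.toReal_prod]
  refine Finset.prod_pos fun i _ => ?_
  rw [ENNReal.toReal_ofReal (by positivity)]
  rcases i with _ | f
  · simp only [n, Option.elim, pow_zero]
    positivity
  · have : 0 < (volume (B (some f))).toNNReal :=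
      ENNReal.toNNReal_pos (Metric.measure_ball_pos volume f.1 hδ).ne' (hv _)
    positivity

end PatternProbability

/-! ### Variance bound by uncorrelated test variables. -/

section Variance

variable {Ω : Type*} [MeasurableSpace Ω] {P : Measure Ω} [IsProbabilityMeasure P]

/-- A lower bound for the variance of a random variable which is correlated with many uncorrelated
bounded random variables. -/
theorem variance_ge_card_mul {ι : Type*} [Fintype ι] {N : Ω → ℝ} (hN : MemLp N 2 P)
    {Z : ι → Ω → ℝ} (hZ : ∀ i, Measurable (Z i)) {B q : ℝ} (hB : 0 < B) (hq : 0 ≤ q)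
    (hZB : ∀ i ω, |Z i ω| ≤ B)
    (hZ0 : ∀ i, ∫ ω, Z i ω ∂P = 0) (hZZ : ∀ i j, i ≠ j → ∫ ω, Z i ω * Z j ω ∂P = 0)
    (hNZ : ∀ i, q ≤ ∫ ω, N ω * Z i ω ∂P) :
    Fintype.card ι * (q ^ 2 / B ^ 2) ≤ Var[N; P] := by
  have hZi : ∀ i, MemLp (Z i) 2 P := fun i => MemLp.of_bound (hZ i).aestronglyMeasurable B
    (Eventually.of_forall fun ω => hZB i ω)
  have hNZi : ∀ i, Integrable (fun ω => N ω * Z i ω) P := fun i => hN.integrable_mul (hZi i)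
  have hZZi : ∀ i j, Integrable (fun ω => Z i ω * Z j ω) P :=
    fun i j => (hZi i).integrable_mul (hZi j)
  set Y : Ω → ℝ := fun ω => ∑ i, Z i ω with hYdef
  have hY : MemLp Y 2 P := memLp_finsetSum _ fun i _ => hZi i
  have hY0 : ∫ ω, Y ω ∂P = 0 := by
    rw [integral_finsetSum _ fun i _ => (hZi i).integrable one_le_two]
    exact Finset.sum_eq_zero fun i _ => hZ0 i
  have hNY : Fintype.card ι * q ≤ ∫ ω, N ω * Y ω ∂P := by
    simp only [Y, Finset.mul_sum]
    rw [integral_finsetSum _ fun i _ => hNZi i]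
    refine le_trans (le_of_eq ?_) (Finset.sum_le_sum fun i _ => hNZ i)
    simp
  have hYY : ∫ ω, Y ω * Y ω ∂P ≤ Fintype.card ι * B ^ 2 := by
    have h1 : ∀ ω, Y ω * Y ω = ∑ i, ∑ j, Z i ω * Z j ω := fun ω => by
      simp only [Y, Finset.sum_mul_sum]
    simp only [h1]
    rw [integral_finsetSum _ fun i _ => integrable_finsetSum _ fun j _ => hZZi i j]
    have h2 : ∀ i, ∫ ω, ∑ j, Z i ω * Z j ω ∂P ≤ B ^ 2 := by
      intro i
      rw [integral_finsetSum _ fun j _ => hZZi i j,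
        Finset.sum_eq_single i (fun j _ hj => hZZ i j hj.symm) (by simp)]
      refine (integral_mono (hZZi i i) (integrable_const (B ^ 2))
        fun ω => ?_).trans (by simp)
      change Z i ω * Z i ω ≤ B ^ 2
      rw [← sq, ← sq_abs]
      exact pow_le_pow_left₀ (abs_nonneg _) (hZB i ω) 2
    refine (Finset.sum_le_sum fun i _ => h2 i).trans ?_
    simp
  have ht : ∀ t : ℝ, 0 ≤ Var[N; P] - 2 * t * ∫ ω, N ω * Y ω ∂P + t ^ 2 * ∫ ω, Y ω * Y ω ∂P := by
    intro t
    have h1 : 0 ≤ Var[fun ω => N ω - t * Y ω; P] := variance_nonneg _ _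
    rw [variance_fun_sub hN (hY.const_mul t), variance_const_mul, covariance_const_mul_right,
      covariance_eq_sub hN hY, hY0, variance_eq_sub hY, hY0] at h1
    simp only [Pi.mul_apply, Pi.pow_apply, mul_zero, sub_zero, sq (Y _)] at h1
    simp at h1
    linarith
  -- This `t` maximizes `2 * t * m * q - t ^ 2 * m * B ^ 2`, where `m` is the number of test
  -- variables.
  have h := ht (q / B ^ 2)
  set m : ℝ := (Fintype.card ι : ℝ)
  have e : q / B ^ 2 * B ^ 2 = q := by field_simp
  have h3 : 0 ≤ q / B ^ 2 := by positivity
  set t := q / B ^ 2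
  have e2 : q ^ 2 / B ^ 2 = t * q := by simp only [t]; ring
  rw [e2]
  have h4 : t * (m * q) ≤ t * ∫ ω, N ω * Y ω ∂P := mul_le_mul_of_nonneg_left hNY h3
  have h5 : t ^ 2 * ∫ ω, Y ω * Y ω ∂P ≤ t ^ 2 * (m * B ^ 2) :=
    mul_le_mul_of_nonneg_left hYY (by positivity)
  have e3 : t ^ 2 * (m * B ^ 2) = t * (m * q) := by rw [← e]; ring
  linarith

end Variance

/-! ### The test variable attached to one switch. -/

section Statistic

variable {Ω α : Type*}

/-- On the event `E`, the difference between the normalized indicators of `A` and `B`. -/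
noncomputable def contrast (E A B : Set Ω) (a b : ℝ) (ω : Ω) : ℝ :=
  E.indicator 1 ω * (A.indicator 1 ω / a - B.indicator 1 ω / b)

theorem abs_contrast_le (E A B : Set Ω) {a b : ℝ} (ha : 0 < a) (hb : 0 < b) (ω : Ω) :
    |contrast E A B a b ω| ≤ 1 / a + 1 / b := by
  have h1 : 0 < 1 / a := by positivity
  have h2 : 0 < 1 / b := by positivity
  unfold contrast
  by_cases hE : ω ∈ E
  · by_cases hA : ω ∈ A <;> by_cases hB : ω ∈ B <;>
      simp only [hE, hA, hB, indicator_of_mem, indicator_of_notMem, not_false_eq_true,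
        Pi.one_apply, one_mul, zero_div] <;>
      rw [abs_le] <;> constructor <;> linarith
  · simp only [hE, indicator_of_notMem, not_false_eq_true, zero_mul, abs_zero]
    positivity

theorem measurable_indicator_one [MeasurableSpace Ω] {E : Set Ω} (hE : MeasurableSet E) :
    Measurable fun ω => E.indicator (1 : Ω → ℝ) ω :=
  measurable_one.indicator hE

theorem measurable_contrast [MeasurableSpace Ω] {E A B : Set Ω} (hE : MeasurableSet E)
    (hA : MeasurableSet A) (hB : MeasurableSet B) (a b : ℝ) : Measurable (contrast E A B a b) :=
  (measurable_one.indicator hE).mul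
    (((measurable_one.indicator hA).div_const a).sub ((measurable_one.indicator hB).div_const b))

variable [MeasurableSpace Ω] [MeasurableSpace α] {X : Ω → Set α} {ν : Measure α} {P : Measure Ω}
  [IsProbabilityMeasure P]

/-- The difference of normalized indicators has mean zero and is independent of everything
determined by `D'`. -/
theorem IsPoissonProcess.integral_mul_contrast (hX : IsPoissonProcess X ν P) {D D' : Set α}
    (hD : Disjoint D' D) {E A B : Set Ω} (hE : MeasurableSet[countSigma X D'] E)
    (hA : MeasurableSet[countSigma X D] A) (hB : MeasurableSet[countSigma X D] B)
    (ha : 0 < P.real A) (hb : 0 < P.real B) {f : Ω → ℝ} (hf : Measurable[countSigma X D'] f) :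
    ∫ ω, f ω * contrast E A B (P.real A) (P.real B) ω ∂P = 0 := by
  have hfE : Measurable[countSigma X D'] fun ω => f ω * E.indicator 1 ω :=
    hf.mul (@measurable_indicator_one Ω (countSigma X D') E hE)
  have hg : Measurable[countSigma X D] fun ω =>
      A.indicator (1 : Ω → ℝ) ω / P.real A - B.indicator 1 ω / P.real B :=
    ((@measurable_indicator_one Ω (countSigma X D) A hA).div_const _).sub
      ((@measurable_indicator_one Ω (countSigma X D) B hB).div_const _)
  have hA' := hX.countSigma_le D _ hA
  have hB' := hX.countSigma_le D _ hB
  have h := hX.integral_mul hD hfE hg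
  have h0 : ∫ ω, (A.indicator (1 : Ω → ℝ) ω / P.real A - B.indicator 1 ω / P.real B) ∂P = 0 := by
    rw [integral_sub, integral_div, integral_div, integral_indicator_one hA',
      integral_indicator_one hB', div_self ha.ne', div_self hb.ne', sub_self]
    · exact ((integrable_const 1).indicator hA').div_const _
    · exact ((integrable_const 1).indicator hB').div_const _
  rw [h0, mul_zero] at h
  rw [← h]
  refine integral_congr_ae (Eventually.of_forall fun ω => ?_)
  simp only [contrast, mul_assoc]

/-- Subtracting `g + m` from `N` does not change the integral. The remainder is nonnegative on `E ∩
A` and at most -1 on `E ∩ B`, so its product with the contrast dominates `1_E 1_B / P(B)`, whose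
mean is `P(E)`. -/
theorem IsPoissonProcess.le_integral_mul_contrast (hX : IsPoissonProcess X ν P) {D D' : Set α}
    (hD : Disjoint D' D) {E A B : Set Ω} (hE : MeasurableSet[countSigma X D'] E)
    (hA : MeasurableSet[countSigma X D] A) (hB : MeasurableSet[countSigma X D] B)
    (ha : 0 < P.real A) (hb : 0 < P.real B) {g N : Ω → ℝ} (hg : Measurable[countSigma X D'] g)
    (hgi : Integrable g P) (hN : Integrable N P) {m : ℝ}
    (hA1 : ∀ᵐ ω ∂P, ω ∈ E → ω ∈ A → g ω + m ≤ N ω)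
    (hB1 : ∀ᵐ ω ∂P, ω ∈ E → ω ∈ B → N ω + 1 ≤ g ω + m) :
    P.real E ≤ ∫ ω, N ω * contrast E A B (P.real A) (P.real B) ω ∂P := by
  have hE' := hX.countSigma_le D' _ hE
  have hA' := hX.countSigma_le D _ hA
  have hB' := hX.countSigma_le D _ hB
  have hZ := measurable_contrast hE' hA' hB' (P.real A) (P.real B)
  have hZb : ∀ᵐ ω ∂P, ‖contrast E A B (P.real A) (P.real B) ω‖ ≤ 1 / P.real A + 1 / P.real B :=
    Eventually.of_forall fun ω => abs_contrast_le E A B ha hb ω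
  have hgm : Measurable[countSigma X D'] fun ω => g ω + m := hg.add measurable_const
  have h1 := hX.integral_mul_contrast hD hE hA hB ha hb hgm
  have h2 := hX.integral_mul hD (@measurable_indicator_one Ω (countSigma X D') E hE)
    ((@measurable_indicator_one Ω (countSigma X D) B hB).div_const (P.real B))
  rw [integral_div, integral_indicator_one hE', integral_indicator_one hB', div_self hb.ne',
    mul_one] at h2
  have hi1 : Integrable (fun ω => (g ω + m) * contrast E A B (P.real A) (P.real B) ω) P :=
    (hgi.add (integrable_const m)).mul_bdd hZ.aestronglyMeasurable hZb
  have hi2 : Integrable (fun ω => E.indicator (1 : Ω → ℝ) ω * (B.indicator 1 ω / P.real B)) P := by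
    refine (((integrable_const (1 : ℝ)).indicator hB').div_const _).bdd_mul (c := 1)
      (measurable_one.indicator hE').aestronglyMeasurable (Eventually.of_forall fun ω => ?_)
    by_cases h : ω ∈ E <;> simp [h]
  rw [← h2, ← zero_add (∫ ω, E.indicator (1 : Ω → ℝ) ω * (B.indicator 1 ω / P.real B) ∂P), ← h1,
    ← integral_add hi1 hi2]
  refine integral_mono_ae (hi1.add hi2) (hN.mul_bdd hZ.aestronglyMeasurable hZb) ?_
  filter_upwards [hA1, hB1] with ω hA1 hB1
  have e1 : 0 < 1 / P.real A := by positivity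
  have e2 : 0 < 1 / P.real B := by positivity
  unfold contrast
  by_cases hE : ω ∈ E
  · by_cases hA : ω ∈ A <;> by_cases hB : ω ∈ B <;>
      simp only [hE, hA, hB, indicator_of_mem, indicator_of_notMem, not_false_eq_true,
        Pi.one_apply, one_mul, zero_div, sub_zero, zero_sub, mul_zero, add_zero, le_refl]
    · linarith [hA1 hE hA, hB1 hE hB]
    · exact mul_le_mul_of_nonneg_right (hA1 hE hA) e1.le
    · nlinarith [hB1 hE hB]
  · simp [hE]

end Statistic

/-! ### Assembling the switches in a large cube. -/

section Main

variable {d : ℕ} {S : Set (Space d)} {Ω : Type*} [MeasurableSpace Ω] {P : Measure Ω}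
  {X : Ω → Set (SpaceTime d)}

/-- The number of accepted points of the process restricted to `D`. -/
noncomputable def acceptedCount (S : Set (Space d)) (X : Ω → Set (SpaceTime d))
    (D : Set (SpaceTime d)) (ω : Ω) : ℝ :=
  ((accepted S (X ω ∩ D)).ncard : ℝ)

theorem IsPoissonProcess.ae_finite_accepted (hS : IsSolid S)
    (hX : IsPoissonProcess X (intensity d) P) {B : Set (Space d)} (hB : Bornology.IsBounded B)
    {D : Set (SpaceTime d)} (hDB : D ⊆ cylinder B) : ∃ C : ℕ, ∀ᵐ ω ∂P,
      FiniteInitial (X ω ∩ D) ∧ (accepted S (X ω ∩ D)).Finite ∧ acceptedCount S X D ω ≤ C := by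
  obtain ⟨C, hC⟩ := hS.accepted_encard_le hB
  refine ⟨C, ?_⟩
  filter_upwards [hX.ae_timeFinite hB] with ω hω
  have hFI : FiniteInitial (X ω ∩ D) := (hω.mono (inter_subset_inter_right _ hDB)).finiteInitial
  have h := hC _ (inter_subset_right.trans hDB) hFI
  have hfin : (accepted S (X ω ∩ D)).Finite :=
    Set.encard_lt_top_iff.1 (h.trans_lt (ENat.natCast_lt_top C))
  refine ⟨hFI, hfin, ?_⟩
  rw [← hfin.cast_ncard_eq] at h
  exact Nat.cast_le.2 (Nat.cast_le.1 h)

variable [IsProbabilityMeasure P]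

theorem IsPoissonProcess.memLp_acceptedCount (hS : IsSolid S)
    (hX : IsPoissonProcess X (intensity d) P) {B : Set (Space d)} (hB : Bornology.IsBounded B)
    {D : Set (SpaceTime d)} (hD : MeasurableSet D) (hDB : D ⊆ cylinder B) :
    MemLp (acceptedCount S X D) 2 P := by
  obtain ⟨g, hg, hgN⟩ := hX.exists_measurable_accepted hS hB hD hDB
  obtain ⟨C, hC⟩ := hX.ae_finite_accepted hS hB hDB
  refine MemLp.of_bound ⟨g, (hg.mono (hX.countSigma_le D) le_rfl).stronglyMeasurable, hgN⟩ C ?_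
  filter_upwards [hC] with ω hω
  rw [Real.norm_eq_abs, abs_of_nonneg (by simp [acceptedCount])]
  exact hω.2.2

/-- The variance of the number of accepted points is at least proportional to the number of
disjoint translates of the region of a switch. -/
theorem IsSwitch.exists_variance_ge {p : Seminorm ℝ (Space d)} {Q W : Set (Space d)} {δ : ℝ}
    {H G G' : Finset (Space d)} (sw : IsSwitch p Q W δ H G G') (hS : IsSolid S)
    (hadj : ∀ x y : SpaceTime d, Adjacent S x y ↔ p (x.1 - y.1) ≤ 1)
    (hX : IsPoissonProcess X (intensity d) P) (hQ : MeasurableSet Q)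
    (hQb : Bornology.IsBounded Q) :
    ∃ κ > 0, ∀ (n : ℕ) (z : Fin n → Space d) (B : Set (Space d)), Bornology.IsBounded B →
      MeasurableSet B → (∀ i, (· - z i) ⁻¹' Q ⊆ B) →
      (∀ i j, i ≠ j → Disjoint ((· - z i) ⁻¹' Q) ((· - z j) ⁻¹' Q)) →
      n * κ ≤ Var[acceptedCount S X (cylinder B); P] := by
  have hdisj : ∀ F : Finset (Space d), (∀ x ∈ H ∪ F, ∀ y ∈ H ∪ F, x ≠ y →
      ∀ x' ∈ Metric.ball x δ, ∀ y' ∈ Metric.ball y δ, 1 < p (x' - y')) →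
      ∀ f ∈ H ∪ F, ∀ g ∈ H ∪ F, f ≠ g → Disjoint (Metric.ball f δ) (Metric.ball g δ) := by
    intro F hF f hf g hg hne
    refine Set.disjoint_left.2 fun x hx hx' => ?_
    have := hF f hf g hg hne x hx x hx'
    rw [sub_self, map_zero] at this
    linarith
  have hWb := hQb.subset sw.subset
  obtain ⟨pE, hpE, hE⟩ := hX.exists_pattern_prob (F := H) sw.pos (hQ.diff sw.measurableSet)
    (hQb.subset sdiff_subset) fun f hf g hg => hdisj G sw.sep_dense f (Finset.mem_union_left _ hf) g
      (Finset.mem_union_left _ hg)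
  obtain ⟨pA, hpA, hA⟩ := hX.exists_pattern_prob (F := G) sw.pos sw.measurableSet hWb
    fun f hf g hg => hdisj G sw.sep_dense f (Finset.mem_union_right _ hf) g
      (Finset.mem_union_right _ hg)
  obtain ⟨pB, hpB, hB⟩ := hX.exists_pattern_prob (F := G') sw.pos sw.measurableSet hWb
    fun f hf g hg => hdisj G' sw.sep_sparse f (Finset.mem_union_right _ hf) g
      (Finset.mem_union_right _ hg)
  refine ⟨pE ^ 2 / (1 / pA + 1 / pB) ^ 2, by positivity, fun n z B hBb hBm hzB hzd => ?_⟩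
  let E : Fin n → Set Ω := fun i => {ω | Pattern (X ω) (z i) (Q \ W) H δ}
  let A : Fin n → Set Ω := fun i => {ω | Pattern (X ω) (z i) W G δ}
  let A' : Fin n → Set Ω := fun i => {ω | Pattern (X ω) (z i) W G' δ}
  have hPE : ∀ i, P.real (E i) = pE := fun i => hE (z i)
  have hPA : ∀ i, P.real (A i) = pA := fun i => hA (z i)
  have hPA' : ∀ i, P.real (A' i) = pB := fun i => hB (z i)
  let V : Fin n → Set (SpaceTime d) := fun i => cylinder ((· - z i) ⁻¹' W)
  have hVm : ∀ i, MeasurableSet (V i) := fun i =>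
    ((measurable_id.sub_const (z i)) sw.measurableSet).prod MeasurableSet.univ
  have hEm : ∀ (i : Fin n) (D : Set (SpaceTime d)), early (z i) (Q \ W) ⊆ D →
      MeasurableSet[countSigma X D] (E i) := fun i D hD =>
    measurableSet_pattern (hQ.diff sw.measurableSet) sw.ball_shell hD
  have hAm : ∀ (i : Fin n) (D : Set (SpaceTime d)), early (z i) W ⊆ D →
      MeasurableSet[countSigma X D] (A i) := fun i D hD =>
    measurableSet_pattern sw.measurableSet sw.ball_dense hD
  have hAm' : ∀ (i : Fin n) (D : Set (SpaceTime d)), early (z i) W ⊆ D →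
      MeasurableSet[countSigma X D] (A' i) := fun i D hD =>
    measurableSet_pattern sw.measurableSet sw.ball_sparse hD
  have hV : ∀ i, early (z i) W ⊆ V i := fun i q hq => ⟨hq.1, mem_univ _⟩
  have hVE : ∀ i, early (z i) (Q \ W) ⊆ (V i)ᶜ := fun i q hq hqV => hq.1.2 hqV.1
  have hVc : ∀ i, Disjoint (V i)ᶜ (V i) := fun i => disjoint_compl_left
  have hother : ∀ i j, i ≠ j → early (z j) Q ⊆ (V i)ᶜ := fun i j hij q hq hqV =>
    Set.disjoint_left.1 (hzd i j hij) (sw.subset hqV.1 : q.1 - z i ∈ Q) hq.1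
  have key : ∀ {ω : Ω} {i : Fin n} {U : Set (Space d)} {F : Finset (Space d)},
      U ⊆ Q → (∀ f ∈ F, Metric.ball f δ ⊆ U) → Pattern (X ω) (z i) U F δ →
      Pattern (X ω ∩ cylinder B) (z i) U F δ := fun {ω i U F} hU hF h =>
    (pattern_inter (D := cylinder B) hF
      (fun q hq => ⟨hzB i (hU hq.1), mem_univ q.2⟩) _).2 h
  obtain ⟨C, hC⟩ := hX.ae_finite_accepted hS hBb (subset_refl (cylinder B))
  have hcyl : MeasurableSet (cylinder B) := hBm.prod MeasurableSet.univ
  have hN := hX.memLp_acceptedCount hS hBb hcyl subset_rfl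
  have hvar := variance_ge_card_mul hN
    (Z := fun i => contrast (E i) (A i) (A' i) pA pB) (B := 1 / pA + 1 / pB) (q := pE)
    (fun i => measurable_contrast
      (hX.countSigma_le _ _ (hEm i _ subset_rfl)) (hX.countSigma_le _ _ (hAm i _ subset_rfl))
      (hX.countSigma_le _ _ (hAm' i _ subset_rfl)) _ _)
    (by positivity) hpE.le (fun i ω => abs_contrast_le _ _ _ hpA hpB ω) ?_ ?_ ?_
  · simpa using hvar
  · intro i
    have h := hX.integral_mul_contrast (hVc i) (hEm i _ (hVE i)) (hAm i _ (hV i))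
      (hAm' i _ (hV i)) (by rw [hPA]; exact hpA) (by rw [hPA']; exact hpB)
      (f := fun _ => 1) measurable_const
    simpa only [hPA, hPA', one_mul] using h
  · intro i j hij
    -- The variable of switch `j` is determined by counts outside the inner cylinder of switch `i`,
    -- so it is orthogonal to the variable of switch `i`.
    have hW : early (z j) W ⊆ (V i)ᶜ := (early_mono sw.subset).trans (hother i j hij)
    have hf : Measurable[countSigma X (V i)ᶜ] (contrast (E j) (A j) (A' j) pA pB) :=
      @measurable_contrast Ω (countSigma X (V i)ᶜ) _ _ _
        (hEm j _ ((early_mono sdiff_subset).trans (hother i j hij))) (hAm j _ hW) (hAm' j _ hW) _ _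
    have h := hX.integral_mul_contrast (hVc i) (hEm i _ (hVE i)) (hAm i _ (hV i))
      (hAm' i _ (hV i)) (by rw [hPA]; exact hpA) (by rw [hPA']; exact hpB) hf
    simp only [hPA, hPA'] at h
    rw [← h]
    exact integral_congr_ae (Eventually.of_forall fun ω => mul_comm _ _)
  · intro i
    -- The reference variable `g` is the count for the input with the inner cylinder deleted;
    -- relative to `g + G.card` the two states fall on opposite sides.
    have hDm : MeasurableSet (cylinder B \ V i) := hcyl.diff (hVm i)
    obtain ⟨g, hg, hgN⟩ := hX.exists_measurable_accepted hS hBb hDm sdiff_subset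
    have hgi : Integrable g P :=
      ((hX.memLp_acceptedCount hS hBb hDm sdiff_subset).integrable one_le_two).congr hgN
    have h := hX.le_integral_mul_contrast (hVc i) (hEm i _ (hVE i)) (hAm i _ (hV i))
      (hAm' i _ (hV i)) (by rw [hPA]; exact hpA) (by rw [hPA']; exact hpB)
      (hg.mono (countSigma_mono fun q hq => hq.2) le_rfl) hgi (hN.integrable one_le_two)
      (m := G.card) ?_ ?_
    · simpa only [hPA, hPA', hPE] using h
    · filter_upwards [hgN, hC] with ω hgω hω hEω hAω
      have h1 := sw.ncard_dense hadj hω.1 hω.2.1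
        (key sdiff_subset sw.ball_shell hEω) (key sw.subset sw.ball_dense hAω)
      rw [inter_sdiff_assoc] at h1
      rw [← hgω, acceptedCount]
      norm_cast
    · filter_upwards [hgN, hC] with ω hgω hω hEω hAω
      have h1 := sw.ncard_sparse hadj hω.1 hω.2.1
        (key sdiff_subset sw.ball_shell hEω) (key sw.subset sw.ball_sparse hAω)
      rw [inter_sdiff_assoc] at h1
      rw [← hgω, acceptedCount]
      norm_cast

theorem cylinder_mono {A B : Set (Space d)} (h : A ⊆ B) : cylinder A ⊆ cylinder B :=
  fun _ hq => ⟨h hq.1, hq.2⟩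

/-- The two scalings cancel, and restricting the count to the closed cube is vacuous because the
input already lies in it. -/
theorem packingNumber_eq {Ω' : Type*} (X : Ω' → Set (SpaceTime d)) {l : ℝ} (hl : 0 < l) :
    packingNumber S X l = acceptedCount S X (cylinder (cube d (l ^ (1 / d : ℝ)) 0)) := by
  ext ω
  set a : ℝ := l ^ (1 / d : ℝ) with ha
  have ha0 : 0 < a := Real.rpow_pos_of_pos hl _
  have hset : scale a (scaledProcess X l ω ∩ cylinder (unitCube d)) =
      X ω ∩ cylinder (cube d a 0) := by
    rw [scaledProcess, Real.rpow_neg hl.le, ← ha]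
    ext q
    constructor
    · rintro ⟨_, ⟨⟨r, hr, rfl⟩, hu, -⟩, rfl⟩
      simp only [smul_inv_smul₀ ha0.ne']
      refine ⟨hr, mem_cube.2 fun i => ?_, mem_univ _⟩
      have h := hu i (mem_univ i)
      simp only [Pi.smul_apply, smul_eq_mul, inv_mul_eq_div, mem_Ico] at h
      rw [le_div_iff₀ ha0, div_lt_iff₀ ha0] at h
      constructor <;> linarith [h.1, h.2]
    · rintro ⟨hq, hqc, -⟩
      refine ⟨(a⁻¹ • q.1, q.2), ⟨⟨q, hq, rfl⟩, fun i _ => ?_, mem_univ _⟩, ?_⟩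
      · have h := mem_cube.1 hqc i
        simp only [Pi.smul_apply, smul_eq_mul, inv_mul_eq_div, mem_Ico]
        rw [le_div_iff₀ ha0, div_lt_iff₀ ha0]
        constructor <;> linarith [h.1, h.2]
      · simp only [smul_inv_smul₀ ha0.ne']
  rw [packingNumber, xiStarScaled, ← ha, hset, xiStar, acceptedCount, inter_eq_left.2]
  refine (accepted_subset _).trans (inter_subset_right.trans (cylinder_mono fun x hx => ?_))
  refine ⟨a⁻¹ • x, ?_, smul_inv_smul₀ ha0.ne' x⟩
  rw [mem_cube] at hx
  constructor <;> intro i <;>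
    simp only [Pi.smul_apply, smul_eq_mul, inv_mul_eq_div, Pi.zero_apply, Pi.one_apply]
  · rw [le_div_iff₀ ha0]; linarith [(hx i).1]
  · rw [div_le_iff₀ ha0]; linarith [(hx i).2]

/-- A large cube contains many disjoint translates of a given cube. -/
theorem exists_disjoint_translates {M r a : ℝ} (hR : 0 < M + 2 * r) (ha : 2 * (M + 2 * r) ≤ a) :
    ∃ (n : ℕ) (z : Fin n → Space d), (a / (2 * (M + 2 * r))) ^ d ≤ n ∧
      (∀ i, (· - z i) ⁻¹' cube d M r ⊆ cube d a 0) ∧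
      ∀ i j, i ≠ j → Disjoint ((· - z i) ⁻¹' cube d M r) ((· - z j) ⁻¹' cube d M r) := by
  set R := M + 2 * r with hRdef
  set m := ⌊a / R⌋₊ with hm
  have hmR : m * R ≤ a := by
    rw [← le_div_iff₀ hR]
    exact Nat.floor_le (div_nonneg (by linarith) hR.le)
  have hmR' : a < (m + 1) * R := by
    rw [← div_lt_iff₀ hR]
    exact Nat.lt_floor_add_one _
  let e := Fintype.equivFin (Fin d → Fin m)
  -- The cube of side `a` is tiled by `m ^ d` cubes of side `R`, up to a remainder; the shift `r`
  -- moves the corner `-r` to the origin. From `2 * R ≤ a` rounding down costs at most a factor 2.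
  refine ⟨_, fun i k => R * (e.symm i k : ℕ) + r, ?_, fun i x hx => ?_, fun i j hij => ?_⟩
  · simp only [Fintype.card_pi, Fintype.card_fin, Finset.prod_const, Finset.card_univ]
    push_cast
    refine pow_le_pow_left₀ (div_nonneg (by linarith) (by linarith)) ?_ d
    rw [div_le_iff₀ (by linarith)]
    linarith
  · rw [mem_preimage, mem_cube] at hx
    rw [mem_cube]
    intro k
    have h1 : (((e.symm i k : ℕ) : ℝ)) + 1 ≤ m := by exact_mod_cast (e.symm i k).2
    have h2 : (0 : ℝ) ≤ ((e.symm i k : ℕ) : ℝ) := by positivity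
    have h3 := hx k
    simp only [Pi.sub_apply] at h3
    constructor <;> nlinarith
  · refine Set.disjoint_left.2 fun x hx hx' => hij (e.symm.injective ?_)
    rw [mem_preimage, mem_cube] at hx hx'
    ext k
    have h1 := hx k
    have h2 := hx' k
    simp only [Pi.sub_apply] at h1 h2
    by_contra hne
    rcases lt_or_gt_of_ne hne with h | h
    · have : ((e.symm i k : ℕ) : ℝ) + 1 ≤ (e.symm j k : ℕ) := by exact_mod_cast h
      nlinarith
    · have : ((e.symm j k : ℕ) : ℝ) + 1 ≤ (e.symm i k : ℕ) := by exact_mod_cast h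
      nlinarith

end Main

end RSA

theorem lemma4p2 {d : ℕ} (hd : 0 < d) {S : Set (RSA.Space d)} (hS : RSA.IsSolid S)
    {Ω : Type*} [MeasurableSpace Ω] (P : Measure Ω) [IsProbabilityMeasure P]
    (X : Ω → Set (RSA.SpaceTime d)) (hX : RSA.IsPoissonProcess X (RSA.intensity d) P) :
    (∀ l : ℝ, 0 < l → MemLp (RSA.packingNumber S X l) 2 P) ∧
      (0 : EReal) <
        liminf (fun l : ℝ => ((l⁻¹ * Var[RSA.packingNumber S X l; P] : ℝ) : EReal)) atTop := by
  constructor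
  · intro l hl
    rw [RSA.packingNumber_eq X hl]
    exact hX.memLp_acceptedCount hS (RSA.isBounded_cube _ _)
      ((RSA.measurableSet_cube _ _).prod MeasurableSet.univ) subset_rfl
  · obtain ⟨p, c, C, hc, hC, hpc, hpC, hadj⟩ := hS.exists_seminorm
    obtain ⟨M, r, δ, W, H, G, G', hR, sw⟩ := RSA.exists_isSwitch hd p hc hC hpc hpC
    obtain ⟨κ, hκ, hvar⟩ := sw.exists_variance_ge hS hadj hX (RSA.measurableSet_cube _ _)
      (RSA.isBounded_cube _ _)
    set R := M + 2 * r with hRdef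
    -- At least `l / (2 * R) ^ d` disjoint switches fit, each contributing `κ` to the variance.
    have hpos : 0 < κ / (2 * R) ^ d := by positivity
    refine lt_of_lt_of_le (EReal.coe_pos.2 hpos) (le_liminf_of_le (by isBoundedDefault) ?_)
    have hd' : (d : ℝ) ≠ 0 := by exact_mod_cast hd.ne'
    have hlarge : ∀ᶠ l : ℝ in atTop, 2 * R ≤ l ^ (1 / d : ℝ) :=
      (tendsto_rpow_atTop (by positivity)).eventually_ge_atTop _
    filter_upwards [hlarge, eventually_gt_atTop 0] with l hl hl0
    rw [EReal.coe_le_coe_iff, RSA.packingNumber_eq X hl0]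
    obtain ⟨n, z, hn, hz, hzd⟩ := RSA.exists_disjoint_translates (d := d) hR hl
    have hv := hvar n z _ (RSA.isBounded_cube _ _) (RSA.measurableSet_cube _ _) hz hzd
    rw [div_pow, ← Real.rpow_natCast (l ^ (1 / d : ℝ)), ← Real.rpow_mul hl0.le,
      one_div_mul_cancel hd', Real.rpow_one] at hn
    rw [inv_mul_eq_div, le_div_iff₀ hl0]
    refine le_trans (le_of_eq ?_) ((mul_le_mul_of_nonneg_right hn hκ.le).trans hv)
    ring
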